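/- Fix a time $t$ (suppressed below). Let $\gamma\in\mathbb R$, $L>0$, and let $\theta:\mathbb R\to\mathbb R$ be $2\pi$-periodic and of class $C^2$. For a $2\pi$-periodic $f$ write $\mathcal F(f)(k)=\frac1{2\pi}\int_{-\pi}^{\pi}f(\alpha)e^{-ik\alpha}\,d\alpha$, and put $\hat\theta(0)=\mathcal F(\theta)(0)$, $\phi=\theta-\hat\theta(0)$. *The equation.* Identify $\mathbb R^2$ with $\mathbb C$. For a $2\pi$-periodic function $\vartheta$, consider the interface of length $L$ with unit tangent $\tau(\alpha)=e^{i(\alpha+\vartheta(\alpha))}$, position $z(\alpha)=\frac{L}{2\pi}\int_0^\alpha\tau(\eta)\,d\eta$ (up to translation), outward normal $n=-i\tau$ and signed curvature $\kappa=\frac{2\pi}{L}(1+\vartheta_\alpha)$. With $G_{ij}(w)=-\delta_{ij}\log|w|+\frac{w_iw_j}{|w|^2}$, the two-dimensional Stokes velocity on the interface with surface tension $\gamma$ is the single-layer potential $$u_j(\alpha)=\frac1{4\pi}\int_{-\pi}^{\pi}\sum_{i=1}^2\bigl(-\gamma\kappa n\bigr)_i(\alpha-\beta)\,G_{ij}\bigl(z(\alpha)-z(\alpha-\beta)\bigr)\frac{L}{2\pi}\,d\beta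 ,\qquad j=1,2 .$$ Let $U=-u\cdot n$ and $T(\alpha)=\int_0^\alpha(1+\vartheta_\eta)U\,d\eta-\frac{\alpha}{2\pi}\int_{-\pi}^{\pi}(1+\vartheta_\eta)U\,d\eta$. The evolution equation is $\vartheta_t=\mathcal R[\vartheta]$, where $\mathcal R[\vartheta]=\frac{2\pi}{L}\bigl(U_\alpha+T(1+\vartheta_\alpha)\bigr)$. Constant $\vartheta$ corresponds to a circle. *The linear part.* Let $\mathcal L(\alpha)=\frac{d}{d\varepsilon}\big|_{\varepsilon=0}\mathcal R[\hat\theta(0)+\varepsilon\phi](\alpha)$, with $L$ held fixed, be the part of the right-hand side that is linear in $\phi$. *Claim.* For all $\varepsilon$ near $0$ and $\vartheta=\hat\theta(0)+\varepsilon\phi$, the integrands defining $u_1(\alpha),u_2(\alpha)$ are integrable for every $\alpha$ and $U$ is of class $C^1$; the derivative defining $\mathcal L(\alpha)$ exists for every $\alpha$; and $\mathcal L$ is continuous and $2\pi$-periodic. Moreover, for integers $k$: 1. if $|k|>1$, then $\displaystyle \mathcal F(\mathcal L)(k)=-\frac{2\pi}{L}\,\frac{\gamma}{4\pi}\,\pi|k|\,\mathcal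 F(\phi)(k)$; 2. consequently, if $|k|>1$, then $\displaystyle \mathcal F(\mathcal L)(k)=-\frac{2\pi}{L}\,\frac{\gamma}{4\pi}\,\pi\,\mathcal F(H\phi_\alpha)(k)$, where $Hf(\alpha)=\frac1{2\pi}\,\mathrm{p.v.}\!\int_{-\pi}^{\pi}f(\alpha-\beta)\cot\frac\beta2\,d\beta$ is the periodic Hilbert transform; 3. if $k=\pm1$, then $\mathcal F(\mathcal L)(k)=0$. -/

import Mathlib

open Filter Topology

noncomputable section

namespace StokesInterface

/-! Everything is at one fixed time. The interface is described by its length `L` and its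
tangent angle `α + θ α`, where `θ` is `2π`-periodic and `L / 2π` is the (constant) speed of the
parametrization. Points and vectors of the plane are complex numbers. -/

/-- The Fourier coefficient `(1/2π) ∫_{-π}^{π} f(α) e^{-ikα} dα`. -/
def fourierMode (f : ℝ → ℝ) (k : ℤ) : ℂ :=
  (1 / (2 * (Real.pi : ℂ))) *
    ∫ α in (-Real.pi)..Real.pi, (f α : ℂ) * Complex.exp (-(Complex.I * (k : ℂ) * (α : ℂ)))

/-- The mean `(1/2π) ∫_{-π}^{π} f`, that is, the zeroth Fourier coefficient as a real number. -/
def mean (f : ℝ → ℝ) : ℝ :=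
  (1 / (2 * Real.pi)) * ∫ α in (-Real.pi)..Real.pi, f α

/-- The fluctuation `φ = θ - θ̂(0)`. -/
def fluctuation (θ : ℝ → ℝ) : ℝ → ℝ := fun α => θ α - mean θ

/-- The periodic Hilbert transform `(1/2π) p.v. ∫_{-π}^{π} f(α - β) cot(β/2) dβ`; the principal
value is written by pairing `β` with `-β`. -/
def hilbertTransform (f : ℝ → ℝ) (α : ℝ) : ℝ :=
  (1 / (2 * Real.pi)) * ∫ β in (0 : ℝ)..Real.pi, (f (α - β) - f (α + β)) * Real.cot (β / 2)

/-- The Cartesian coordinates of a vector of the plane. -/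
def coord (w : ℂ) : Fin 2 → ℝ := ![w.re, w.im]

/-- The Stokes kernel `G_ij(w) = -δ_ij log |w| + w_i w_j / |w|²`. -/
def stokeslet (i j : Fin 2) (w : ℂ) : ℝ :=
  -(if i = j then 1 else 0) * Real.log ‖w‖ + coord w i * coord w j / ‖w‖ ^ 2

/-- The unit tangent `τ = e^{i(α + θ)}`. -/
def tangent (θ : ℝ → ℝ) (α : ℝ) : ℂ :=
  Complex.exp (Complex.I * ((α + θ α : ℝ) : ℂ))

/-- The outward unit normal `n = -i e^{i(α + θ)}`. -/
def normal (θ : ℝ → ℝ) (α : ℝ) : ℂ := -Complex.I * tangent θ α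

/-- The interface `z(α) = (L/2π) ∫_0^α e^{i(η + θ(η))} dη`, normalized by `z(0) = 0` (only
differences of points of the interface matter). -/
def curve (L : ℝ) (θ : ℝ → ℝ) (α : ℝ) : ℂ :=
  ((L / (2 * Real.pi) : ℝ) : ℂ) * ∫ η in (0 : ℝ)..α, tangent θ η

/-- The signed curvature `κ`, with `dτ/ds = -κ n`: the derivative of the tangent angle with
respect to arclength, `ds = (L/2π) dα`. -/
def curvature (L : ℝ) (θ : ℝ → ℝ) (α : ℝ) : ℝ :=
  (2 * Real.pi / L) * (1 + deriv θ α)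

/-- The integrand of the single-layer potential at `z(α)`, in the variable `β` of the
integration point `z(α - β)`: `∑_i (-γ κ n)_i G_ij(z(α) - z(α - β)) ds/dβ`. -/
def layerIntegrand (γ L : ℝ) (θ : ℝ → ℝ) (j : Fin 2) (α β : ℝ) : ℝ :=
  (∑ i : Fin 2, -γ * curvature L θ (α - β) * coord (normal θ (α - β)) i *
    stokeslet i j (curve L θ α - curve L θ (α - β))) * (L / (2 * Real.pi))

/-- The `j`-th component of the fluid velocity at the point `z(α)` of the interface. -/
def velocity (γ L : ℝ) (θ : ℝ → ℝ) (j : Fin 2) (α : ℝ) : ℝ :=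
  (1 / (4 * Real.pi)) * ∫ β in (-Real.pi)..Real.pi, layerIntegrand γ L θ j α β

/-- The normal speed `U = u · (-n)`. -/
def normalSpeed (γ L : ℝ) (θ : ℝ → ℝ) (α : ℝ) : ℝ :=
  -∑ j : Fin 2, velocity γ L θ j α * coord (normal θ α) j

/-- The tangential speed
`T(α) = ∫_0^α (1 + θ_η) U dη - (α/2π) ∫_{-π}^{π} (1 + θ_η) U dη`, in the frame `T(0) = 0`. -/
def tangentialSpeed (γ L : ℝ) (θ : ℝ → ℝ) (α : ℝ) : ℝ :=
  (∫ η in (0 : ℝ)..α, (1 + deriv θ η) * normalSpeed γ L θ η) -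
    (α / (2 * Real.pi)) *
      ∫ η in (-Real.pi)..Real.pi, (1 + deriv θ η) * normalSpeed γ L θ η

/-- The right-hand side of the evolution equation
`θ_t = (2π/L) (U_α + T (1 + θ_α))`. -/
def thetaRHS (γ L : ℝ) (θ : ℝ → ℝ) (α : ℝ) : ℝ :=
  (2 * Real.pi / L) *
    (deriv (normalSpeed γ L θ) α + tangentialSpeed γ L θ α * (1 + deriv θ α))

/-- The tangent angle functions `θ̂(0) + ε φ`, joining the circle `θ̂(0)` (at `ε = 0`) to
`θ = θ̂(0) + φ` (at `ε = 1`). -/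
def perturbed (θ : ℝ → ℝ) (ε : ℝ) : ℝ → ℝ := fun α => mean θ + ε * fluctuation θ α

/-- The principal linear part `𝓛`: the part of the right-hand side of the evolution equation for
`θ` that is linear in `φ`, that is, its derivative at the circle `θ̂(0)` in the direction `φ`. -/
def linearPart (γ L : ℝ) (θ : ℝ → ℝ) (α : ℝ) : ℝ :=
  deriv (fun ε : ℝ => thetaRHS γ L (perturbed θ ε) α) 0

end StokesInterface

end

open MeasureTheory intervalIntegral

/-! The circle is a steady state, and the linearization there commutes with rotations, so the claim
reduces to computing two Fourier multipliers.

Put φ = `fluctuation θ` and R = L/2π. The chord from z(α-β) to z(α) is β R τ(α) q, where q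
(`chordRatio`) averages e^{iδ} along the arc; only increments of the tangent angle enter, so the
curve need not close up. Contracting the Stokes kernel with the two normals
(`sum_stokeslet_contract`) leaves -log|β| cos δ plus a kernel that is regular where q ≠ 0
(`normalSpeed_perturbed`). On the circle |q| = sinc(β/2) > 0 for |β| ≤ π, and compactness keeps q ≠
0 for small ε. Thus U is a C² layer potential plus ε times a C¹ one.

Since U vanishes on the circle (`layerPotential_circle`), Hadamard's lemma gives U = εN with N of
class C¹. The whole right-hand side is then ε times a function of ε continuous at 0, and its
derivative at 0 is the value of that function (`hasDerivAt_thetaRHS`). With V = N(0,·) this value is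
2π/L times V' plus a primitive of V minus its mean. On mode k ≠ 0 that operation is ik + 1/(ik) =
i(k - 1/k), which vanishes at k = ±1 (`fourierMode_circleVariation`).

Here V is γ/4π times `linearSpeed`, whose multiplier for k ≥ 2 is iπk²/(k²-1)
(`fourierMode_linearSpeed_nat`): iπ comes from the kernel log|2 sin(β/2)|, with cosine integrals
-π/n, and iπ/(k²-1) from the variation of the chord length. The product of the two multipliers is
-πk. Negative k follow by conjugation, and the Hilbert form follows because H multiplies positive
modes by -i. -/

/-! ### Smoothness of parameter integrals with an integrable weight -/

/-- The weight is only integrable, so that it can carry the singularity log|β|. Compactness of the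
interval bounds the derivative of `f` uniformly for parameters near `p₀`, which gives the dominating
function |w|(C + 1). -/
theorem hasFDerivAt_integral_smul_of_contDiffAt {P E : Type} [NormedAddCommGroup P]
    [NormedSpace ℝ P] [NormedAddCommGroup E] [NormedSpace ℝ E]
    {a b : ℝ} {w : ℝ → ℝ} (hw : IntervalIntegrable w volume a b) {f : P × ℝ → E} {p₀ : P}
    (hf : ∀ β ∈ Set.uIcc a b, ContDiffAt ℝ 1 f (p₀, β)) :
    HasFDerivAt (fun p => ∫ β in a..b, w β • f (p, β))
      (∫ β in a..b, w β • (fderiv ℝ f (p₀, β)).comp (ContinuousLinearMap.inl ℝ P ℝ)) p₀ := by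
  have hcont : ContinuousOn (fun β => fderiv ℝ f (p₀, β)) (Set.uIcc a b) := fun β hβ =>
    (ContinuousAt.comp (f := fun β : ℝ => (p₀, β)) ((hf β hβ).continuousAt_fderiv one_ne_zero)
      (by fun_prop)).continuousWithinAt
  obtain ⟨C, hC⟩ := isCompact_uIcc.exists_bound_of_continuousOn hcont
  have hev : ∀ᶠ p in 𝓝 p₀, ∀ β ∈ Set.uIcc a b,
      ContDiffAt ℝ 1 f (p, β) ∧ ‖fderiv ℝ f (p, β)‖ < C + 1 := by
    refine isCompact_uIcc.eventually_forall_of_forall_eventually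
      (P := fun p β => ContDiffAt ℝ 1 f (p, β) ∧ ‖fderiv ℝ f (p, β)‖ < C + 1) fun β hβ => ?_
    have h1 := (hf β hβ).eventually (by simp)
    have h2 := ((hf β hβ).continuousAt_fderiv one_ne_zero).norm.eventually
      (gt_mem_nhds (lt_of_le_of_lt (hC β hβ) (lt_add_one C)))
    filter_upwards [h1, h2] with z hz1 hz2 using ⟨hz1, hz2⟩
  have hmeas : ∀ p, (∀ β ∈ Set.uIcc a b, ContDiffAt ℝ 1 f (p, β)) →
      ContinuousOn (fun β => f (p, β)) (Set.uIcc a b) := fun p hp β hβ =>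
    (ContinuousAt.comp (f := fun β : ℝ => (p, β)) (hp β hβ).continuousAt
      (by fun_prop)).continuousWithinAt
  have hsm : ∀ {F : Type} [NormedAddCommGroup F] [NormedSpace ℝ F] {g : ℝ → F},
      ContinuousOn g (Set.uIcc a b) →
      AEStronglyMeasurable (fun β => w β • g β) (volume.restrict (Set.uIoc a b)) :=
          fun {F} _ _ {g} hg =>
    hw.def'.aestronglyMeasurable.smul
      ((hg.mono Set.uIoc_subset_uIcc).aestronglyMeasurable measurableSet_uIoc)
  refine (intervalIntegral.hasFDerivAt_integral_of_dominated_of_fderiv_le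
    (F := fun p β => w β • f (p, β))
    (F' := fun p β => w β • (fderiv ℝ f (p, β)).comp (ContinuousLinearMap.inl ℝ P ℝ))
    (bound := fun β => |w β| * (C + 1)) hev ?_ ?_ ?_ ?_ ?_ ?_)
  · filter_upwards [hev] with p hp using hsm (hmeas p fun β hβ => (hp β hβ).1)
  · exact hw.smul_continuousOn (hmeas p₀ hf)
  · exact hsm (hcont.clm_comp continuousOn_const)
  · refine Eventually.of_forall fun β hβ p hp => ?_
    have h := hp β (Set.uIoc_subset_uIcc hβ)
    rw [norm_smul, Real.norm_eq_abs]
    refine mul_le_mul_of_nonneg_left ?_ (abs_nonneg _)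
    calc _ ≤ ‖fderiv ℝ f (p, β)‖ * ‖ContinuousLinearMap.inl ℝ P ℝ‖ :=
          ContinuousLinearMap.opNorm_comp_le _ _
      _ ≤ ‖fderiv ℝ f (p, β)‖ * 1 := by
          gcongr; exact ContinuousLinearMap.norm_inl_le_one ℝ P ℝ
      _ ≤ C + 1 := by rw [mul_one]; exact h.2.le
  · exact hw.abs.mul_const _
  · refine Eventually.of_forall fun β hβ p hp => ?_
    have h := (hp β (Set.uIoc_subset_uIcc hβ)).1
    exact ((h.differentiableAt one_ne_zero).hasFDerivAt.comp p
      (hasFDerivAt_prodMk_left p β)).const_smul (w β)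

theorem continuousAt_integral_smul {P E : Type} [TopologicalSpace P] [FirstCountableTopology P]
    [NormedAddCommGroup E] [NormedSpace ℝ E]
    {a b : ℝ} {w : ℝ → ℝ} (hw : IntervalIntegrable w volume a b) {f : P × ℝ → E} {p₀ : P}
    (hf : ∀ β ∈ Set.uIcc a b, ∀ᶠ z in 𝓝 (p₀, β), ContinuousAt f z) :
    ContinuousAt (fun p => ∫ β in a..b, w β • f (p, β)) p₀ := by
  have hcont : ContinuousOn (fun β => f (p₀, β)) (Set.uIcc a b) := fun β hβ =>
    (ContinuousAt.comp (f := fun β : ℝ => (p₀, β)) (hf β hβ).self_of_nhds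
      (by fun_prop)).continuousWithinAt
  obtain ⟨C, hC⟩ := isCompact_uIcc.exists_bound_of_continuousOn hcont
  have hev : ∀ᶠ p in 𝓝 p₀, ∀ β ∈ Set.uIcc a b, ContinuousAt f (p, β) ∧ ‖f (p, β)‖ < C + 1 := by
    refine isCompact_uIcc.eventually_forall_of_forall_eventually
      (P := fun p β => ContinuousAt f (p, β) ∧ ‖f (p, β)‖ < C + 1) fun β hβ => ?_
    have h2 := (hf β hβ).self_of_nhds.norm.eventually
      (gt_mem_nhds (lt_of_le_of_lt (hC β hβ) (lt_add_one C)))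
    filter_upwards [hf β hβ, h2] with z hz1 hz2 using ⟨hz1, hz2⟩
  refine intervalIntegral.continuousAt_of_dominated_interval
    (bound := fun β => |w β| * (C + 1)) ?_ ?_ (hw.abs.mul_const _) ?_
  · filter_upwards [hev] with p hp
    have : ContinuousOn (fun β => f (p, β)) (Set.uIcc a b) := fun β hβ =>
      (ContinuousAt.comp (f := fun β : ℝ => (p, β)) (hp β hβ).1
        (by fun_prop)).continuousWithinAt
    exact hw.def'.aestronglyMeasurable.smul
      ((this.mono Set.uIoc_subset_uIcc).aestronglyMeasurable measurableSet_uIoc)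
  · filter_upwards [hev] with p hp
    refine Eventually.of_forall fun β hβ => ?_
    rw [norm_smul, Real.norm_eq_abs]
    exact mul_le_mul_of_nonneg_left (hp β (Set.uIoc_subset_uIcc hβ)).2.le (abs_nonneg _)
  · refine Eventually.of_forall fun β hβ => ?_
    exact (ContinuousAt.comp (f := fun p : P => (p, β))
      (hf β (Set.uIoc_subset_uIcc hβ)).self_of_nhds (by fun_prop)).const_smul (w β)

/-- The derivative is again a weighted integral of the same kind, with values in the linear maps
from `P` to `E`; hence the induction on `n` runs over all `E`. -/
theorem contDiffAt_integral_smul {P E : Type} [NormedAddCommGroup P]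
    [NormedSpace ℝ P] [NormedAddCommGroup E] [NormedSpace ℝ E]
    {a b : ℝ} {w : ℝ → ℝ} (hw : IntervalIntegrable w volume a b) (n : ℕ) {f : P × ℝ → E} {p₀ : P}
    (hf : ∀ β ∈ Set.uIcc a b, ContDiffAt ℝ n f (p₀, β)) :
    ContDiffAt ℝ n (fun p => ∫ β in a..b, w β • f (p, β)) p₀ := by
  induction n generalizing E with
  | zero =>
    have hev : ∀ᶠ p in 𝓝 p₀, ∀ β ∈ Set.uIcc a b, ∀ᶠ z in 𝓝 (p, β), ContinuousAt f z := by
      refine isCompact_uIcc.eventually_forall_of_forall_eventually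
        (P := fun p β => ∀ᶠ z in 𝓝 (p, β), ContinuousAt f z) fun β hβ =>
          (((hf β hβ).eventually (by simp)).mono fun z hz => hz.continuousAt).eventually_nhds
    exact contDiffAt_zero.2 ⟨_, hev, fun p hp =>
      (continuousAt_integral_smul hw hp).continuousWithinAt⟩
  | succ n ih =>
    have hev : ∀ᶠ p in 𝓝 p₀, ∀ β ∈ Set.uIcc a b, ContDiffAt ℝ 1 f (p, β) :=
      isCompact_uIcc.eventually_forall_of_forall_eventually
        (P := fun p β => ContDiffAt ℝ 1 f (p, β)) fun β hβ =>
          ((hf β hβ).of_le (by norm_cast; omega)).eventually (by simp)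
    rw [Nat.cast_succ]
    refine contDiffAt_succ_iff_hasFDerivAt.2 ⟨_, ⟨_, hev, fun p hp =>
      hasFDerivAt_integral_smul_of_contDiffAt hw hp⟩, ?_⟩
    exact ih fun β hβ => ((hf β hβ).fderiv_right (m := n) (by norm_cast)).clm_comp
      contDiffAt_const

/-! ### The chord ratio and its nonvanishing near the circle -/

namespace StokesInterface

/-- The increment `δ` of the tangent angle `α + ε φ` from `α` to `α - β`. -/
noncomputable def angleIncrement (φ : ℝ → ℝ) (x : (ℝ × ℝ) × ℝ) : ℝ :=
  -x.2 + x.1.1 * (φ (x.1.2 - x.2) - φ x.1.2)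

/-- The chord from `z(α - β)` to `z(α)`, divided by `β` and by the speed of the parametrization,
in the frame of the tangent at `α`. -/
noncomputable def chordRatio (φ : ℝ → ℝ) (x : (ℝ × ℝ) × ℝ) : ℂ :=
  ∫ t in (0 : ℝ)..1, Complex.exp (Complex.I * (angleIncrement φ (x.1, x.2 * t) : ℝ))

/-- The part of the normal-normal Stokes kernel that stays bounded on the diagonal. -/
noncomputable def regularKernel (R : ℝ) (φ : ℝ → ℝ) (x : (ℝ × ℝ) × ℝ) : ℝ :=
  (1 / 2 - Real.log R - Real.log ‖chordRatio φ x‖) * Real.cos (angleIncrement φ x) -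
    1 / 2 * (Complex.exp (Complex.I * (angleIncrement φ x : ℝ)) *
      (starRingEnd ℂ (chordRatio φ x) / chordRatio φ x)).re

theorem contDiff_angleIncrement {φ : ℝ → ℝ} {n : ℕ} (hφ : ContDiff ℝ n φ) :
    ContDiff ℝ n (angleIncrement φ) := by
  unfold angleIncrement
  fun_prop

theorem contDiff_chordRatio {φ : ℝ → ℝ} {n : ℕ} (hφ : ContDiff ℝ n φ) :
    ContDiff ℝ n (chordRatio φ) := by
  have h : ContDiff ℝ n fun z : ((ℝ × ℝ) × ℝ) × ℝ =>
      Complex.exp (Complex.I * (angleIncrement φ (z.1.1, z.1.2 * z.2) : ℝ)) := by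
    refine (contDiff_const.mul (Complex.ofRealCLM.contDiff.comp
      ((contDiff_angleIncrement hφ).comp ?_))).cexp
    fun_prop
  refine contDiff_iff_contDiffAt.2 fun x => ?_
  have := contDiffAt_integral_smul (a := 0) (b := 1) (w := fun _ => 1) (by simp) n
    (f := fun z : ((ℝ × ℝ) × ℝ) × ℝ =>
      Complex.exp (Complex.I * (angleIncrement φ (z.1.1, z.1.2 * z.2) : ℝ))) (p₀ := x)
    fun β _ => h.contDiffAt
  simp only [one_smul] at this
  exact this

theorem contDiffAt_regularKernel (R : ℝ) {φ : ℝ → ℝ} {n : ℕ} (hφ : ContDiff ℝ n φ)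
    {x : (ℝ × ℝ) × ℝ} (hx : chordRatio φ x ≠ 0) : ContDiffAt ℝ n (regularKernel R φ) x := by
  have h1 := (contDiff_angleIncrement hφ).contDiffAt (x := x)
  have h2 := (contDiff_chordRatio hφ).contDiffAt (x := x)
  refine ((contDiffAt_const.sub ((h2.norm ℝ hx).log (norm_ne_zero_iff.2 hx))).mul h1.cos).sub
    (contDiffAt_const.mul (Complex.reCLM.contDiff.contDiffAt.comp x (ContDiffAt.mul ?_ ?_)))
  · exact (contDiffAt_const.mul (Complex.ofRealCLM.contDiff.contDiffAt.comp x h1)).cexp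
  · simp only [div_eq_mul_inv]
    exact (Complex.conjCLE.contDiff.contDiffAt.comp x h2).mul (h2.inv hx)

/-- A chord of the circle makes half the central angle with the tangent, and its length divided by
the arc length is sinc(β/2). -/
theorem chordRatio_circle (φ : ℝ → ℝ) (α β : ℝ) :
    chordRatio φ ((0, α), β) =
      Complex.exp (-(Complex.I * (β / 2 : ℝ))) * (Real.sinc (β / 2) : ℝ) := by
  simp only [chordRatio, angleIncrement, zero_mul, add_zero]
  rcases eq_or_ne β 0 with rfl | hβ
  · simp
  · have hβ' : (β : ℂ) ≠ 0 := by exact_mod_cast hβ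
    have h := integral_exp_mul_complex (a := 0) (b := 1) (c := -(Complex.I * β))
      (by simp [hβ])
    have e : ∀ t : ℝ, Complex.exp (Complex.I * ((-(β * t) : ℝ) : ℂ)) =
        Complex.exp (-(Complex.I * β) * t) := fun t => by push_cast; ring_nf
    simp only [e, h]
    rw [Real.sinc_of_ne_zero (by simpa using hβ)]
    push_cast
    rw [Complex.sin, show -(Complex.I * (β : ℂ)) * 1 = -(Complex.I * (β / 2 : ℂ)) +
      -(Complex.I * (β / 2 : ℂ)) by ring, Complex.exp_add,
      show -((β : ℂ) / 2) * Complex.I = -(Complex.I * (β / 2 : ℂ)) by ring,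
      show ((β : ℂ) / 2) * Complex.I = (Complex.I * (β / 2 : ℂ)) by ring]
    have h1 : Complex.exp (-(Complex.I * (β / 2 : ℂ))) * Complex.exp (Complex.I * (β / 2 : ℂ)) =
        1 := by
      rw [← Complex.exp_add]; simp
    simp only [mul_zero, Complex.exp_zero]
    generalize Complex.exp (-(Complex.I * (β / 2 : ℂ))) = A at h1 ⊢
    generalize Complex.exp (Complex.I * (β / 2 : ℂ)) = B at h1 ⊢
    have hI := Complex.I_sq
    field_simp
    linear_combination -h1 - (A * A - A * B) * hI

theorem sinc_half_pos {β : ℝ} (hβ : β ∈ Set.Icc (-Real.pi) Real.pi) : 0 < Real.sinc (β / 2) := by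
  have pos : ∀ x : ℝ, 0 < x → x ≤ Real.pi → 0 < Real.sinc (x / 2) := fun x h0 h1 => by
    rw [Real.sinc_of_ne_zero (by positivity)]
    exact div_pos (Real.sin_pos_of_pos_of_lt_pi (by positivity)
      (by linarith)) (by positivity)
  rcases lt_trichotomy β 0 with h | rfl | h
  · rw [← Real.sinc_neg, ← neg_div]
    exact pos (-β) (by linarith) (by linarith [hβ.1])
  · simp
  · exact pos β h hβ.2

theorem chordRatio_circle_ne_zero (φ : ℝ → ℝ) (α : ℝ) {β : ℝ}
    (hβ : β ∈ Set.Icc (-Real.pi) Real.pi) : chordRatio φ ((0, α), β) ≠ 0 := by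
  rw [chordRatio_circle]
  exact mul_ne_zero (Complex.exp_ne_zero _) (by exact_mod_cast (sinc_half_pos hβ).ne')

theorem norm_chordRatio_circle (φ : ℝ → ℝ) (α : ℝ) {β : ℝ}
    (hβ : β ∈ Set.Icc (-Real.pi) Real.pi) :
    ‖chordRatio φ ((0, α), β)‖ = Real.sinc (β / 2) := by
  rw [chordRatio_circle, norm_mul, Complex.norm_real, Real.norm_eq_abs,
    abs_of_pos (sinc_half_pos hβ),
    ← mul_neg, ← Complex.ofReal_neg, Complex.norm_exp_I_mul_ofReal, one_mul]

/-- A chord of a circle meets the tangents at its two ends at equal angles. The value 1 is the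
largest real part of a unimodular number, which is why this term later has no first variation. -/
theorem exp_mul_conj_chordRatio_circle (φ : ℝ → ℝ) (α : ℝ) {β : ℝ}
    (hβ : β ∈ Set.Icc (-Real.pi) Real.pi) :
    Complex.exp (Complex.I * ((-β : ℝ) : ℂ)) *
      (starRingEnd ℂ (chordRatio φ ((0, α), β)) / chordRatio φ ((0, α), β)) = 1 := by
  rw [chordRatio_circle, map_mul, Complex.conj_ofReal, ← Complex.exp_conj,
    mul_div_mul_right _ _ (by exact_mod_cast (sinc_half_pos hβ).ne'), ← Complex.exp_sub,
    ← Complex.exp_add, Complex.exp_eq_one_iff]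
  refine ⟨0, ?_⟩
  simp only [map_neg, map_mul, Complex.conj_I, Complex.conj_ofReal]
  push_cast
  ring

/-- The ratio depends on α through φ alone, so it is periodic in α and only a compact rectangle of
pairs (α, β) matters. -/
theorem eventually_chordRatio_ne_zero {φ : ℝ → ℝ} (hφ : Continuous φ)
    (hper : Function.Periodic φ (2 * Real.pi)) :
    ∀ᶠ ε in 𝓝 (0 : ℝ), ∀ α : ℝ, ∀ β ∈ Set.Icc (-Real.pi) Real.pi,
      chordRatio φ ((ε, α), β) ≠ 0 := by
  have hc : Continuous (chordRatio φ) :=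
    (contDiff_chordRatio (n := 0) (by exact_mod_cast contDiff_zero.2 hφ)).continuous
  have h := (isCompact_Icc.prod isCompact_Icc : IsCompact
      (Set.Icc (0 :
          ℝ) (2 * Real.pi) ×ˢ Set.Icc (-Real.pi) Real.pi)).eventually_forall_of_forall_eventually
      (x₀ := (0 : ℝ)) (P := fun ε y => chordRatio φ ((ε, y.1), y.2) ≠ 0) ?_
  · filter_upwards [h] with ε hε α β hβ
    have hp : Function.Periodic (fun α => chordRatio φ ((ε, α), β)) (2 * Real.pi) := fun α => by
      simp only [chordRatio, angleIncrement, hper α, add_sub_right_comm α, hper _]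
    obtain ⟨y, hy, e⟩ := hp.exists_mem_Ico₀ Real.two_pi_pos α
    have e' : chordRatio φ ((ε, α), β) = chordRatio φ ((ε, y), β) := e
    rw [e']
    exact hε (y, β) ⟨Set.Ico_subset_Icc_self hy, hβ⟩
  · rintro ⟨α, β⟩ ⟨-, hβ⟩
    have hcont : Continuous fun z : ℝ × (ℝ × ℝ) => chordRatio φ ((z.1, z.2.1), z.2.2) := by fun_prop
    refine hcont.continuousAt.eventually_ne ?_
    exact chordRatio_circle_ne_zero φ α hβ

/-! ### The normal speed with its logarithmic singularity split off -/

theorem contDiff_fluctuation {θ : ℝ → ℝ} {n : ℕ} (hθ : ContDiff ℝ n θ) :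
    ContDiff ℝ n (fluctuation θ) := hθ.sub contDiff_const

theorem periodic_fluctuation {θ : ℝ → ℝ} (hper : Function.Periodic θ (2 * Real.pi)) :
    Function.Periodic (fluctuation θ) (2 * Real.pi) := fun α => by simp [fluctuation, hper α]

theorem deriv_perturbed {θ : ℝ → ℝ} (hθ : Differentiable ℝ θ) (ε α : ℝ) :
    deriv (perturbed θ ε) α = ε * deriv (fluctuation θ) α := by
  unfold perturbed
  rw [deriv_const_add, deriv_const_mul (d := fluctuation θ) _ ((hθ.sub_const _) α)]

theorem tangent_perturbed (θ : ℝ → ℝ) (ε α β : ℝ) :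
    tangent (perturbed θ ε) (α - β) = tangent (perturbed θ ε) α *
      Complex.exp (Complex.I * (angleIncrement (fluctuation θ) ((ε, α), β) : ℝ)) := by
  rw [tangent, tangent, ← Complex.exp_add, ← mul_add, ← Complex.ofReal_add]
  congr 3
  simp only [perturbed, angleIncrement]
  ring

theorem norm_tangent (ϑ : ℝ → ℝ) (α : ℝ) : ‖tangent ϑ α‖ = 1 := by
  rw [tangent, Complex.norm_exp_I_mul_ofReal]

theorem continuous_tangent {ϑ : ℝ → ℝ} (h : Continuous ϑ) : Continuous (tangent ϑ) := by
  unfold tangent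
  fun_prop

theorem continuous_perturbed {θ : ℝ → ℝ} (hθ : Continuous θ) (ε : ℝ) :
    Continuous (perturbed θ ε) := by
  unfold perturbed fluctuation
  fun_prop

theorem curve_sub_curve {θ : ℝ → ℝ} (hθ : Continuous θ) (L ε α β : ℝ) :
    curve L (perturbed θ ε) α - curve L (perturbed θ ε) (α - β) =
      (β : ℂ) * (((L / (2 * Real.pi) : ℝ) : ℂ) * tangent (perturbed θ ε) α *
        chordRatio (fluctuation θ) ((ε, α), β)) := by
  have hc := continuous_tangent (continuous_perturbed hθ ε)
  rw [curve, curve, ← mul_sub, integral_interval_sub_left (hc.intervalIntegrable _ _)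
    (hc.intervalIntegrable _ _)]
  have h := smul_integral_comp_sub_mul (a := 0) (b := 1) (tangent (perturbed θ ε)) β α
  rw [mul_zero, mul_one, sub_zero] at h
  rw [← h, Complex.real_smul]
  simp only [tangent_perturbed, intervalIntegral.integral_const_mul]
  rw [chordRatio]
  ring

/-- Negative β is covered because `Real.log β` is log|β|. -/
theorem stokeslet_ofReal_mul (i j : Fin 2) {β : ℝ} (hβ : β ≠ 0) {w : ℂ} (hw : w ≠ 0) :
    stokeslet i j (β * w) = -(if i = j then 1 else 0) * Real.log β + stokeslet i j w := by
  have hn : ‖w‖ ≠ 0 := norm_ne_zero_iff.2 hw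
  have hc : ∀ i, coord (β * w) i = β * coord w i := fun i => by
    fin_cases i <;> simp [coord]
  simp only [stokeslet, norm_mul, Complex.norm_real, Real.norm_eq_abs, hc]
  rw [Real.log_mul (abs_ne_zero.2 hβ) hn, Real.log_abs, mul_pow, sq_abs]
  field_simp
  ring

theorem continuousAt_stokeslet (i j : Fin 2) {w : ℂ} (hw : w ≠ 0) :
    ContinuousAt (stokeslet i j) w := by
  have hn : ‖w‖ ≠ 0 := norm_ne_zero_iff.2 hw
  have hc : ∀ i, Continuous fun w => coord w i := fun i => by
    fin_cases i
    · exact Complex.continuous_re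
    · exact Complex.continuous_im
  exact (continuousAt_const.mul (continuousAt_id.norm.log hn)).add
    (((hc i).continuousAt.mul (hc j).continuousAt).div (continuousAt_id.norm.pow 2)
      (pow_ne_zero 2 hn))

theorem continuous_coord (i : Fin 2) : Continuous fun w => coord w i := by
  fin_cases i
  · exact Complex.continuous_re
  · exact Complex.continuous_im

/-- In complex notation (m·w)(n·w)/|w|² is half of Re(m n̄) + Re(m n w̄/w), since w̄²/|w|² = w̄/w.
-/
theorem sum_stokeslet_contract (m n : ℂ) {w : ℂ} (hw : w ≠ 0) :
    ∑ j : Fin 2, (∑ i : Fin 2, coord m i * stokeslet i j w) * coord n j =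
      (1 / 2 - Real.log ‖w‖) * (m * starRingEnd ℂ n).re +
        1 / 2 * (m * n * (starRingEnd ℂ w / w)).re := by
  obtain ⟨S, hS⟩ : ∃ S, S = w.re * w.re + w.im * w.im := ⟨_, rfl⟩
  have hS' : S = Complex.normSq w := by rw [hS, Complex.normSq_apply]
  have hn : S ≠ 0 := hS' ▸ (Complex.normSq_pos.2 hw).ne'
  have hs : ‖w‖ ^ 2 = S := by rw [← Complex.normSq_eq_norm_sq, hS']
  have hd : starRingEnd ℂ w / w = (starRingEnd ℂ w) ^ 2 / (S : ℂ) := by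
    rw [hS', ← Complex.mul_conj, pow_two,
      mul_div_mul_right _ _ ((map_ne_zero (starRingEnd ℂ)).2 hw)]
  rw [hd, ← mul_div_assoc, Complex.div_ofReal_re]
  simp only [Fin.sum_univ_two, stokeslet, coord, hs]
  simp [pow_two]
  field_simp
  rw [hS]
  ring

/-- The chord is β times the nonvanishing continuous `Q`, so the Stokes kernel is a multiple of
log|β| plus a continuous function. -/
theorem intervalIntegrable_layerIntegrand {θ : ℝ → ℝ} (hθ : ContDiff ℝ 1 θ) (γ : ℝ) {L : ℝ}
    (hL : 0 < L) {ε α : ℝ}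
    (hq : ∀ β ∈ Set.Icc (-Real.pi) Real.pi, chordRatio (fluctuation θ) ((ε, α), β) ≠ 0)
    (j : Fin 2) :
    IntervalIntegrable (layerIntegrand γ L (perturbed θ ε) j α) volume (-Real.pi) Real.pi := by
  set Q : ℝ → ℂ := fun β => ((L / (2 * Real.pi) : ℝ) : ℂ) * tangent (perturbed θ ε) α *
    chordRatio (fluctuation θ) ((ε, α), β) with hQ
  have hIcc : Set.uIcc (-Real.pi) Real.pi = Set.Icc (-Real.pi) Real.pi :=
    Set.uIcc_of_le (by linarith [Real.pi_pos])
  have hQ0 : ∀ β ∈ Set.Icc (-Real.pi) Real.pi, Q β ≠ 0 := fun β hβ =>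
    mul_ne_zero (mul_ne_zero (by exact_mod_cast (by positivity : L / (2 * Real.pi) ≠ 0))
      (norm_ne_zero_iff.1 (by rw [norm_tangent]; exact one_ne_zero))) (hq β hβ)
  have hQc : Continuous Q := continuous_const.mul
    ((contDiff_chordRatio (n := 1) (contDiff_fluctuation hθ)).continuous.comp (by fun_prop))
  have hk : Continuous fun β => curvature L (perturbed θ ε) (α - β) := by
    simp only [curvature, deriv_perturbed (hθ.differentiable one_ne_zero)]
    have : Continuous (deriv (fluctuation θ)) :=
      (contDiff_fluctuation (n := 1) hθ).continuous_deriv le_rfl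
    fun_prop
  have hn : ∀ i, Continuous fun β => coord (normal (perturbed θ ε) (α - β)) i := fun i =>
    (continuous_coord i).comp (continuous_const.mul
      ((continuous_tangent (continuous_perturbed hθ.continuous ε)).comp (by fun_prop)))
  have hG : IntervalIntegrable (fun β => (∑ i : Fin 2, -γ * curvature L (perturbed θ ε) (α - β) *
      coord (normal (perturbed θ ε) (α - β)) i *
        (-(if i = j then 1 else 0) * Real.log β + stokeslet i j (Q β))) * (L / (2 * Real.pi)))
      volume (-Real.pi) Real.pi := by
    refine IntervalIntegrable.mul_const ?_ _
    simp only [Fin.sum_univ_two]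
    have key : ∀ i, IntervalIntegrable (fun β => -γ * curvature L (perturbed θ ε) (α - β) *
        coord (normal (perturbed θ ε) (α - β)) i *
        (-(if i = j then 1 else 0) * Real.log β + stokeslet i j (Q β)))
        volume (-Real.pi) Real.pi := fun i => by
      refine IntervalIntegrable.continuousOn_mul (IntervalIntegrable.add
        (intervalIntegrable_log'.const_mul _) (ContinuousOn.intervalIntegrable ?_))
        (by have := hn i; fun_prop)
      intro β hβ
      exact ((continuousAt_stokeslet i j (hQ0 β (hIcc ▸ hβ))).comp
        hQc.continuousAt).continuousWithinAt
    exact (key 0).add (key 1)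
  refine hG.congr_ae ?_
  refine (ae_restrict_iff' measurableSet_uIoc).2 ?_
  filter_upwards [compl_mem_ae_iff.2 (measure_singleton (0 : ℝ))] with β hβ hβI
  simp only [layerIntegrand, curve_sub_curve hθ.continuous]
  refine congrArg (· * _) (Finset.sum_congr rfl fun i _ => ?_)
  rw [stokeslet_ofReal_mul i j hβ (hQ0 β (hIcc ▸ Set.uIoc_subset_uIcc hβI))]

/-- The tangent at α drops out by rotation invariance, the arclength factor L/2π cancels the 2π/L in
the curvature, and the signs in U = -u·n and in the force -γκn cancel. -/
theorem normalSpeed_perturbed {θ : ℝ → ℝ} (hθ : ContDiff ℝ 1 θ) (γ : ℝ) {L : ℝ} (hL : 0 < L)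
    {ε α : ℝ}
    (hq : ∀ β ∈ Set.Icc (-Real.pi) Real.pi, chordRatio (fluctuation θ) ((ε, α), β) ≠ 0) :
    normalSpeed γ L (perturbed θ ε) α = γ / (4 * Real.pi) * ∫ β in (-Real.pi)..Real.pi,
      (1 + ε * deriv (fluctuation θ) (α - β)) *
        (-Real.log β * Real.cos (angleIncrement (fluctuation θ) ((ε, α), β)) +
          regularKernel (L / (2 * Real.pi)) (fluctuation θ) ((ε, α), β)) := by
  have hI := intervalIntegrable_layerIntegrand hθ γ hL hq
  simp only [normalSpeed, velocity, Fin.sum_univ_two]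
  rw [mul_assoc, mul_assoc, ← mul_add, ← intervalIntegral.integral_mul_const,
      ← intervalIntegral.integral_mul_const,
    ← intervalIntegral.integral_add ((hI 0).mul_const _) ((hI 1).mul_const _), ← neg_mul,
        ← intervalIntegral.integral_const_mul,
    ← intervalIntegral.integral_const_mul]
  refine intervalIntegral.integral_congr_ae ?_
  filter_upwards [compl_mem_ae_iff.2 (measure_singleton (0 : ℝ))] with β hβ hβI
  have hqβ := hq β (by
    rw [← Set.uIcc_of_le (by linarith [Real.pi_pos] : -Real.pi ≤ Real.pi)]
    exact Set.uIoc_subset_uIcc hβI)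
  have hβ : β ≠ 0 := hβ
  have hτ := norm_tangent (perturbed θ ε) α
  have hR : 0 < L / (2 * Real.pi) := by positivity
  have hRC : ((L / (2 * Real.pi) : ℝ) : ℂ) ≠ 0 := by exact_mod_cast hR.ne'
  have hτ0 : tangent (perturbed θ ε) α ≠ 0 :=
    norm_ne_zero_iff.1 (by rw [hτ]; exact one_ne_zero)
  have hβC : (β : ℂ) ≠ 0 := by exact_mod_cast hβ
  have hw := mul_ne_zero hβC (mul_ne_zero (mul_ne_zero hRC hτ0) hqβ)
  have hs := sum_stokeslet_contract (normal (perturbed θ ε) (α - β)) (normal (perturbed θ ε) α) hw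
  have hlog : Real.log ‖(β : ℂ) * (((L / (2 * Real.pi) : ℝ) : ℂ) * tangent (perturbed θ ε) α *
      chordRatio (fluctuation θ) ((ε, α), β))‖ = Real.log β + Real.log (L / (2 * Real.pi)) +
        Real.log ‖chordRatio (fluctuation θ) ((ε, α), β)‖ := by
    rw [norm_mul, norm_mul, norm_mul, hτ, mul_one, Complex.norm_real, Complex.norm_real,
      Real.norm_eq_abs, Real.norm_eq_abs, abs_of_pos hR, Real.log_mul (abs_ne_zero.2 hβ)
      (mul_ne_zero hR.ne' (norm_ne_zero_iff.2 hqβ)), Real.log_mul hR.ne' (norm_ne_zero_iff.2 hqβ),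
      Real.log_abs, add_assoc]
  have hττ : tangent (perturbed θ ε) α * starRingEnd ℂ (tangent (perturbed θ ε) α) = 1 := by
    rw [Complex.mul_conj, Complex.normSq_eq_norm_sq, hτ]; simp
  have h1 : normal (perturbed θ ε) (α - β) * starRingEnd ℂ (normal (perturbed θ ε) α) =
      Complex.exp (Complex.I * (angleIncrement (fluctuation θ) ((ε, α), β) : ℝ)) := by
    rw [normal, normal, tangent_perturbed, map_mul, map_neg, Complex.conj_I]
    generalize Complex.exp (Complex.I * (angleIncrement (fluctuation θ) ((ε, α), β) : ℝ)) = e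
    linear_combination (-(Complex.I ^ 2) * e) * hττ - e * Complex.I_sq
  -- The quotient w̄/w ignores the real factors β and R and contributes τ̄/τ, which cancels the τ²
  -- of the two normals; the sign is (-i)².
  have h2 : normal (perturbed θ ε) (α - β) * normal (perturbed θ ε) α *
      (starRingEnd ℂ ((β : ℂ) * (((L / (2 * Real.pi) : ℝ) : ℂ) * tangent (perturbed θ ε) α *
        chordRatio (fluctuation θ) ((ε, α), β))) / ((β : ℂ) * (((L / (2 * Real.pi) : ℝ) : ℂ) *
          tangent (perturbed θ ε) α * chordRatio (fluctuation θ) ((ε, α), β)))) =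
      -(Complex.exp (Complex.I * (angleIncrement (fluctuation θ) ((ε, α), β) : ℝ)) *
      (starRingEnd ℂ (chordRatio (fluctuation θ) ((ε, α), β)) /
        chordRatio (fluctuation θ) ((ε, α), β))) := by
    rw [normal, normal, tangent_perturbed, map_mul, map_mul, map_mul, Complex.conj_ofReal,
      Complex.conj_ofReal]
    generalize tangent (perturbed θ ε) α = τ at *
    generalize ((L / (2 * Real.pi) : ℝ) : ℂ) = R at *
    generalize chordRatio (fluctuation θ) ((ε, α), β) = q at *
    generalize Complex.exp (Complex.I * (angleIncrement (fluctuation θ) ((ε, α), β) : ℝ)) = e at *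
    field_simp
    have hI := Complex.I_sq
    linear_combination (e * starRingEnd ℂ q * Complex.I ^ 2) * hττ + e * starRingEnd ℂ q * hI
  rw [hlog, h1, h2, mul_comm Complex.I, Complex.exp_ofReal_mul_I_re, mul_comm _ Complex.I,
      Complex.neg_re] at hs
  have hs' : ∀ S : ℝ, S = _ → S =
      -Real.log β * Real.cos (angleIncrement (fluctuation θ) ((ε, α), β)) +
        regularKernel (L / (2 * Real.pi)) (fluctuation θ) ((ε, α), β) := fun S hS => by
    rw [hS.trans hs, regularKernel]
    ring
  replace hs' := hs' _ rfl
  have hLπ : 2 * Real.pi / L * (L / (2 * Real.pi)) = 1 := by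
    field_simp
  simp only [layerIntegrand, curve_sub_curve hθ.continuous, curvature,
    deriv_perturbed (hθ.differentiable one_ne_zero), Fin.sum_univ_two] at hs' ⊢
  generalize deriv (fluctuation θ) (α - β) = d at *
  generalize -Real.log β * Real.cos (angleIncrement (fluctuation θ) ((ε, α), β)) +
      regularKernel (L / (2 * Real.pi)) (fluctuation θ) ((ε, α), β) = K at *
  linear_combination (1 / (4 * Real.pi) * γ * (1 + ε * d)) *
    (2 * Real.pi / L * (L / (2 * Real.pi)) * hs' + K * hLπ)

/-! ### Fourier coefficients of the logarithm of the chord -/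

/-- The logarithm of the chord `|1 - e^{iβ}|` of the unit circle. -/
noncomputable def logChord (β : ℝ) : ℝ := Real.log (2 * Real.sin (β / 2))

theorem intervalIntegrable_logChord (a b : ℝ) : IntervalIntegrable logChord volume a b := by
  have h : MeromorphicOn (fun β : ℝ => 2 * Real.sin (β / 2)) (Set.uIcc a b) := fun x _ =>
    AnalyticAt.meromorphicAt (by fun_prop)
  exact h.intervalIntegrable_log

theorem logChord_neg (β : ℝ) : logChord (-β) = logChord β := by
  rw [logChord, neg_div, Real.sin_neg, mul_neg, Real.log_neg_eq_log, logChord]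

/-- The differences sin((j+1)β) - sin(jβ) telescope. The point is the explicit factor sin(β/2),
which absorbs the singularities of cot(β/2) and of the logarithm. -/
theorem sin_nat_mul_eq (n : ℕ) (β : ℝ) :
    Real.sin (n * β) = 2 * Real.sin (β / 2) * ∑ j ∈ Finset.range n, Real.cos ((j + 1 / 2) * β) := by
  induction n with
  | zero => simp
  | succ n ih =>
    rw [Finset.sum_range_succ, mul_add, ← ih]
    push_cast
    have e1 : ((n : ℝ) + 1) * β = (n + 1 / 2) * β + β / 2 := by ring
    have e2 : (n : ℝ) * β = (n + 1 / 2) * β - β / 2 := by ring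
    rw [e1, e2, Real.sin_add, Real.sin_sub]
    ring

theorem two_cos_half_mul_sum (n : ℕ) (β : ℝ) :
    2 * Real.cos (β / 2) * ∑ j ∈ Finset.range n, Real.cos ((j + 1 / 2) * β) =
      ∑ j ∈ Finset.range n, (Real.cos (j * β) + Real.cos ((j + 1 : ℕ) * β)) := by
  rw [Finset.mul_sum]
  refine Finset.sum_congr rfl fun j _ => ?_
  have e1 : ((j + 1 : ℕ) : ℝ) * β = (j + 1 / 2) * β + β / 2 := by push_cast; ring
  have e2 : (j : ℝ) * β = (j + 1 / 2) * β - β / 2 := by ring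
  rw [e1, e2, Real.cos_add, Real.cos_sub]
  ring

theorem integral_cos_nat_mul_zero_pi {n : ℕ} (hn : n ≠ 0) :
    ∫ β in (0 : ℝ)..Real.pi, Real.cos (n * β) = 0 := by
  have hn' : (n : ℝ) ≠ 0 := by exact_mod_cast hn
  rw [intervalIntegral.integral_comp_mul_left (fun x => Real.cos x) hn', integral_cos]
  simp [Real.sin_nat_mul_pi]

/-- Only the constant cos(0·β), occurring once at j = 0, has a nonzero integral. -/
theorem integral_sum_cos {n : ℕ} (hn : n ≠ 0) :
    ∫ β in (0 : ℝ)..Real.pi,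
      ∑ j ∈ Finset.range n, (Real.cos (j * β) + Real.cos ((j + 1 : ℕ) * β)) = Real.pi := by
  have hi : ∀ m : ℕ, IntervalIntegrable (fun β : ℝ => Real.cos (m * β)) volume 0 Real.pi :=
    fun m => Continuous.intervalIntegrable (by fun_prop) _ _
  rw [intervalIntegral.integral_finsetSum fun j _ => (hi j).add (hi (j + 1))]
  obtain ⟨m, rfl⟩ := Nat.exists_eq_succ_of_ne_zero hn
  rw [Finset.sum_range_succ', Finset.sum_eq_zero fun j _ => ?_]
  · rw [intervalIntegral.integral_add (hi 0) (hi (0 + 1)),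
      integral_cos_nat_mul_zero_pi (n := 0 + 1) (by simp)]
    simp
  · rw [intervalIntegral.integral_add (hi _) (hi _), integral_cos_nat_mul_zero_pi (by simp),
      integral_cos_nat_mul_zero_pi (by simp), add_zero]

theorem integral_sin_mul_cot {n : ℕ} (hn : n ≠ 0) :
    ∫ β in (0 : ℝ)..Real.pi, Real.sin (n * β) * Real.cot (β / 2) = Real.pi := by
  refine (intervalIntegral.integral_congr_ae (Eventually.of_forall fun β hβ => ?_)).trans
    (integral_sum_cos hn)
  rw [Set.uIoc_of_le Real.pi_pos.le] at hβ
  have hs : Real.sin (β / 2) ≠ 0 :=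
    (Real.sin_pos_of_pos_of_lt_pi (by linarith [hβ.1]) (by linarith [hβ.2, hβ.1])).ne'
  rw [sin_nat_mul_eq, ← two_cos_half_mul_sum, Real.cot_eq_cos_div_sin]
  field_simp

/-- Integration by parts against sin(nβ). With x = 2 sin(β/2) the product `logChord` · sin(nβ) is (x
log x) · S, hence continuous up to β = 0, and it vanishes at both ends; the other term is half of
the integral of sin(nβ) cot(β/2). -/
theorem integral_logChord_mul_cos_zero_pi {n : ℕ} (hn : n ≠ 0) :
    ∫ β in (0 : ℝ)..Real.pi, logChord β * Real.cos (n * β) = -(Real.pi / (2 * n)) := by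
  have hn' : (n : ℝ) ≠ 0 := by exact_mod_cast hn
  set S : ℝ → ℝ := fun β => ∑ j ∈ Finset.range n, Real.cos ((j + 1 / 2) * β) with hS
  have hSc : Continuous S := by fun_prop
  have hF : Continuous fun β : ℝ => 2 * Real.sin (β / 2) * Real.log (2 * Real.sin (β / 2)) * S β :=
    (Real.continuous_mul_log.comp (by fun_prop : Continuous fun β :
        ℝ => 2 * Real.sin (β / 2))).mul hSc
  have hFe : (fun β : ℝ => 2 * Real.sin (β / 2) * Real.log (2 * Real.sin (β / 2)) * S β) =
      fun β => logChord β * Real.sin (n * β) := by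
    funext β
    rw [sin_nat_mul_eq, logChord]
    ring
  rw [hFe] at hF
  have hint1 : IntervalIntegrable (fun β => logChord β * Real.cos (n * β)) volume 0 Real.pi :=
    (intervalIntegrable_logChord _ _).mul_continuousOn (by fun_prop)
  have hint2 : IntervalIntegrable (fun β => Real.cos (β / 2) * S β) volume 0 Real.pi :=
    Continuous.intervalIntegrable (by fun_prop) _ _
  have h := integral_eq_sub_of_hasDerivAt_of_le Real.pi_pos.le hF.continuousOn
    (f' := fun β => Real.cos (β / 2) * S β + n * (logChord β * Real.cos (n * β))) (fun β hβ => ?_)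
    (hint2.add (hint1.const_mul _))
  · rw [intervalIntegral.integral_add hint2 (hint1.const_mul _),
      intervalIntegral.integral_const_mul] at h
    have h2 : ∫ β in (0 : ℝ)..Real.pi, Real.cos (β / 2) * S β = Real.pi / 2 := by
      have h3 := integral_sum_cos hn
      simp only [← two_cos_half_mul_sum, mul_assoc, intervalIntegral.integral_const_mul] at h3
      linarith
    rw [h2] at h
    simp only [Real.sin_nat_mul_pi, mul_zero, Real.sin_zero, sub_zero] at h
    field_simp
    linarith
  · have hs : Real.sin (β / 2) ≠ 0 :=
      (Real.sin_pos_of_pos_of_lt_pi (by linarith [hβ.1]) (by linarith [hβ.2, hβ.1])).ne'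
    have h1 : HasDerivAt logChord (2 * (Real.cos (β / 2) * (1 / 2)) / (2 * Real.sin (β / 2))) β :=
      ((((hasDerivAt_id' β).div_const 2).sin).const_mul 2).log (mul_ne_zero two_ne_zero hs)
    have h2 : HasDerivAt (fun β : ℝ => Real.sin (n * β)) (Real.cos (n * β) * (n * 1)) β :=
      ((hasDerivAt_id' β).const_mul (n : ℝ)).sin
    refine (h1.mul h2).congr_deriv ?_
    rw [sin_nat_mul_eq]
    change _ * (2 * Real.sin (β / 2) * S β) + _ = _
    field_simp

theorem integral_neg_pi_pi_eq_two_mul {f : ℝ → ℝ} (hf : ∀ x, f (-x) = f x)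
    (hi : ∀ a b, IntervalIntegrable f volume a b) :
    ∫ β in (-Real.pi)..Real.pi, f β = 2 * ∫ β in (0 : ℝ)..Real.pi, f β := by
  have h := intervalIntegral.integral_comp_neg (a := 0) (b := Real.pi) f
  simp only [hf, neg_zero] at h
  rw [← integral_add_adjacent_intervals (hi _ 0) (hi _ _), ← h]
  ring

theorem integral_neg_pi_pi_eq_zero {f : ℝ → ℝ} (hf : ∀ x, f (-x) = -f x) :
    ∫ β in (-Real.pi)..Real.pi, f β = 0 := by
  have h := intervalIntegral.integral_comp_neg (a := -Real.pi) (b := Real.pi) f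
  simp only [hf, neg_neg, intervalIntegral.integral_neg] at h
  linarith

theorem integral_logChord_mul_cos {n : ℕ} (hn : n ≠ 0) :
    ∫ β in (-Real.pi)..Real.pi, logChord β * Real.cos (n * β) = -(Real.pi / n) := by
  rw [integral_neg_pi_pi_eq_two_mul (fun x => by rw [logChord_neg, mul_neg, Real.cos_neg])
    fun a b => (intervalIntegrable_logChord a b).mul_continuousOn (by fun_prop),
    integral_logChord_mul_cos_zero_pi hn]
  field_simp

theorem integral_logChord_mul_sin (n : ℕ) :
    ∫ β in (-Real.pi)..Real.pi, logChord β * Real.sin (n * β) = 0 :=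
  integral_neg_pi_pi_eq_zero fun x => by rw [logChord_neg, mul_neg, Real.sin_neg, mul_neg]

theorem exp_neg_I_mul_eq (x : ℝ) :
    Complex.exp (-(Complex.I * x)) = (Real.cos x : ℂ) - Complex.I * (Real.sin x : ℂ) := by
  rw [show -(Complex.I * (x : ℂ)) = ((-x : ℝ) : ℂ) * Complex.I by push_cast; ring,
    Complex.exp_mul_I, ← Complex.ofReal_cos, ← Complex.ofReal_sin, Real.cos_neg, Real.sin_neg]
  push_cast
  ring

theorem intervalIntegrable_ofReal {f : ℝ → ℝ} {a b : ℝ} (hf : IntervalIntegrable f volume a b) :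
    IntervalIntegrable (fun x => (f x : ℂ)) volume a b :=
  ⟨hf.1.ofReal, hf.2.ofReal⟩

theorem integral_logChord_mul_exp {n : ℕ} (hn : n ≠ 0) :
    ∫ β in (-Real.pi)..Real.pi, (logChord β : ℂ) * Complex.exp (-(Complex.I * (n * β : ℝ))) =
      -(Real.pi / n) := by
  have h1 : IntervalIntegrable (fun β => ((logChord β * Real.cos (n * β) : ℝ) : ℂ)) volume
      (-Real.pi) Real.pi := intervalIntegrable_ofReal
    ((intervalIntegrable_logChord _ _).mul_continuousOn (by fun_prop))
  have h2 : IntervalIntegrable (fun β => ((logChord β * Real.sin (n * β) : ℝ) : ℂ)) volume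
      (-Real.pi) Real.pi := intervalIntegrable_ofReal
    ((intervalIntegrable_logChord _ _).mul_continuousOn (by fun_prop))
  have e : ∀ β : ℝ, (logChord β : ℂ) * Complex.exp (-(Complex.I * (n * β : ℝ))) =
      ((logChord β * Real.cos (n * β) : ℝ) : ℂ) -
        Complex.I * ((logChord β * Real.sin (n * β) : ℝ) : ℂ) := fun β => by
    rw [exp_neg_I_mul_eq]
    push_cast
    ring
  simp only [e]
  rw [intervalIntegral.integral_sub h1 (h2.const_mul _), intervalIntegral.integral_const_mul,
    intervalIntegral.integral_ofReal, intervalIntegral.integral_ofReal,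
    integral_logChord_mul_cos hn, integral_logChord_mul_sin]
  push_cast
  ring

theorem integral_exp_neg_I_mul {n : ℕ} (hn : n ≠ 0) :
    ∫ β in (-Real.pi)..Real.pi, Complex.exp (-(Complex.I * (n * β : ℝ))) = 0 := by
  have e : ∀ β : ℝ, Complex.exp (-(Complex.I * (n * β : ℝ))) =
      Complex.exp (-(Complex.I * n) * β) := fun β => by push_cast; ring_nf
  simp only [e]
  rw [integral_exp_mul_complex (by simpa using hn), div_eq_zero_iff, sub_eq_zero]
  left
  rw [Complex.exp_eq_exp_iff_exists_int]
  exact ⟨-n, by push_cast; ring⟩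

end StokesInterface

/-! ### First variation of the kernel at the circle -/

theorem hasDerivAt_integral_smul_of_contDiffAt {E : Type} [NormedAddCommGroup E] [NormedSpace ℝ E]
    [CompleteSpace E]
    {a b : ℝ} {w : ℝ → ℝ} (hw : IntervalIntegrable w volume a b) {f : ℝ × ℝ → E} {p₀ : ℝ}
    (hf : ∀ β ∈ Set.uIcc a b, ContDiffAt ℝ 1 f (p₀, β)) {f' : ℝ → E}
    (hf' : ∀ β ∈ Set.uIcc a b, HasDerivAt (fun p => f (p, β)) (f' β) p₀) :
    HasDerivAt (fun p => ∫ β in a..b, w β • f (p, β)) (∫ β in a..b, w β • f' β) p₀ := by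
  have hcont : ContinuousOn (fun β => fderiv ℝ f (p₀, β)) (Set.uIcc a b) := fun β hβ =>
    (ContinuousAt.comp (f := fun β : ℝ => (p₀, β)) ((hf β hβ).continuousAt_fderiv one_ne_zero)
      (by fun_prop)).continuousWithinAt
  refine (hasFDerivAt_integral_smul_of_contDiffAt hw hf).hasDerivAt.congr_deriv ?_
  rw [ContinuousLinearMap.intervalIntegral_apply
    (hw.smul_continuousOn (hcont.clm_comp continuousOn_const))]
  refine intervalIntegral.integral_congr fun β hβ => ?_
  have h := (((hf β hβ).differentiableAt one_ne_zero).hasFDerivAt.comp p₀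
    (hasFDerivAt_prodMk_left p₀ β)).hasDerivAt.unique (hf' β hβ)
  change w β • (((fderiv ℝ f (p₀, β)).comp (ContinuousLinearMap.inl ℝ ℝ ℝ)) 1) = w β • f' β
  rw [h]

namespace StokesInterface

/-- The relative variation of the length of the chord of the circle from `α - β` to `α`, when the
tangent angle varies by `φ`. -/
noncomputable def chordVariation (φ : ℝ → ℝ) (α β : ℝ) : ℝ :=
  ∫ t in (0 : ℝ)..1, Real.sin (β * (t - 1 / 2)) / Real.sinc (β / 2) * (φ (α - β * t) - φ α)

theorem hasDerivAt_angleIncrement (φ : ℝ → ℝ) (α β ε : ℝ) :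
    HasDerivAt (fun ε => angleIncrement φ ((ε, α), β)) (φ (α - β) - φ α) ε := by
  simpa [angleIncrement] using ((hasDerivAt_id' ε).mul_const (φ (α - β) - φ α)).const_add (-β)

theorem angleIncrement_circle (φ : ℝ → ℝ) (α β : ℝ) : angleIncrement φ ((0, α), β) = -β := by
  simp [angleIncrement]

theorem hasDerivAt_cos_angleIncrement (φ : ℝ → ℝ) (α β : ℝ) :
    HasDerivAt (fun ε => Real.cos (angleIncrement φ ((ε, α), β)))
      (Real.sin β * (φ (α - β) - φ α)) 0 := by
  refine (hasDerivAt_angleIncrement φ α β 0).cos.congr_deriv ?_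
  rw [angleIncrement_circle, Real.sin_neg, neg_neg]

theorem hasDerivAt_exp_angleIncrement (φ : ℝ → ℝ) (α β : ℝ) :
    HasDerivAt (fun ε : ℝ => Complex.exp (Complex.I * (angleIncrement φ ((ε, α), β) : ℝ)))
      (Complex.exp (Complex.I * ((-β : ℝ) : ℂ)) * (Complex.I * ((φ (α - β) - φ α : ℝ) : ℂ))) 0 := by
  have h := ((hasDerivAt_angleIncrement φ α β 0).ofReal_comp.const_mul Complex.I).cexp
  rwa [angleIncrement_circle] at h

theorem hasDerivAt_chordRatio {φ : ℝ → ℝ} (hφ : ContDiff ℝ 1 φ) (α β : ℝ) :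
    HasDerivAt (fun ε => chordRatio φ ((ε, α), β))
      (∫ t in (0 : ℝ)..1, Complex.exp (Complex.I * ((-(β * t) : ℝ) : ℂ)) *
        (Complex.I * ((φ (α - β * t) - φ α : ℝ) : ℂ))) 0 := by
  have h : ContDiff ℝ 1 fun z : ℝ × ℝ =>
      Complex.exp (Complex.I * (angleIncrement φ ((z.1, α), β * z.2) : ℝ)) := by
    refine (contDiff_const.mul (Complex.ofRealCLM.contDiff.comp
      ((contDiff_angleIncrement (n := 1) hφ).comp ?_))).cexp
    fun_prop
  have := hasDerivAt_integral_smul_of_contDiffAt (a := 0) (b := 1) (w := fun _ => 1) (by simp)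
    (f := fun z : ℝ × ℝ => Complex.exp (Complex.I * (angleIncrement φ ((z.1, α), β * z.2) : ℝ)))
    (p₀ := 0) (fun t _ => h.contDiffAt) fun t _ => hasDerivAt_exp_angleIncrement φ α (β * t)
  simp only [one_smul] at this
  exact this

theorem hasDerivAt_log_norm {q : ℝ → ℂ} {q' : ℂ} {x : ℝ} (hq : HasDerivAt q q' x) (h0 : q x ≠ 0) :
    HasDerivAt (fun ε => Real.log ‖q ε‖) (q' / q x).re x := by
  have hn : ‖q x‖ ^ 2 ≠ 0 := pow_ne_zero 2 (norm_ne_zero_iff.2 h0)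
  have h := (hq.norm_sq.log hn).const_mul (1 / 2 : ℝ)
  have e : (fun ε => Real.log ‖q ε‖) = fun ε => 1 / 2 * Real.log (‖q ε‖ ^ 2) := by
    funext ε
    rw [Real.log_pow]
    push_cast
    ring
  rw [e]
  refine h.congr_deriv ?_
  rw [← Complex.normSq_eq_norm_sq, Complex.inner, Complex.div_re]
  simp
  ring

theorem re_div_chordRatio {φ : ℝ → ℝ} (hφ : Continuous φ) (α : ℝ) {β : ℝ}
    (hβ : β ∈ Set.Icc (-Real.pi) Real.pi) :
    ((∫ t in (0 : ℝ)..1, Complex.exp (Complex.I * ((-(β * t) : ℝ) : ℂ)) *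
        (Complex.I * ((φ (α - β * t) - φ α : ℝ) : ℂ))) / chordRatio φ ((0, α), β)).re =
      chordVariation φ α β := by
  have hs : (Real.sinc (β / 2) : ℂ) ≠ 0 := by exact_mod_cast (sinc_half_pos hβ).ne'
  rw [← intervalIntegral.integral_div, ← Complex.reCLM_apply,
    ← Complex.reCLM.intervalIntegral_comp_comm (Continuous.intervalIntegrable (by fun_prop) _ _)]
  refine intervalIntegral.integral_congr fun t _ => ?_
  -- Centring at the midpoint t = 1/2 splits off exactly the phase of the chord ratio of the circle,
  -- so the quotient by it has a real denominator.
  have e : Complex.exp (Complex.I * ((-(β * t) : ℝ) : ℂ)) =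
      Complex.exp (-(Complex.I * ((β * (t - 1 / 2) : ℝ) : ℂ))) *
        Complex.exp (-(Complex.I * ((β / 2 : ℝ) : ℂ))) := by
    rw [← Complex.exp_add]
    congr 1
    push_cast
    ring
  have e2 : Complex.exp (Complex.I * ((-(β * t) : ℝ) : ℂ)) *
      (Complex.I * ((φ (α - β * t) - φ α : ℝ) : ℂ)) / chordRatio φ ((0, α), β) =
      ((Real.cos (β * (t - 1 / 2)) : ℂ) - Complex.I * (Real.sin (β * (t - 1 / 2)) : ℂ)) *
        (Complex.I * ((φ (α - β * t) - φ α : ℝ) : ℂ)) / (Real.sinc (β / 2) : ℂ) := by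
    rw [chordRatio_circle, e, exp_neg_I_mul_eq (β * (t - 1 / 2))]
    have := Complex.exp_ne_zero (-(Complex.I * ((β / 2 : ℝ) : ℂ)))
    field_simp
  simp only [Complex.reCLM_apply, e2, Complex.div_ofReal_re]
  generalize Real.sin (β * (t - 1 / 2)) = x
  generalize Real.cos (β * (t - 1 / 2)) = y
  simp
  ring

/-- The factor e^{iδ} q̄/q is unimodular and equals 1 on the circle, so its derivative is imaginary
and its real part contributes nothing. What remains is the variation of cos δ and of log|q|. -/
theorem hasDerivAt_regularKernel (R : ℝ) {φ : ℝ → ℝ} (hφ : ContDiff ℝ 1 φ) (α : ℝ) {β : ℝ}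
    (hβ : β ∈ Set.Icc (-Real.pi) Real.pi) :
    HasDerivAt (fun ε => regularKernel R φ ((ε, α), β))
      ((1 / 2 - Real.log R - Real.log (Real.sinc (β / 2))) * (Real.sin β * (φ (α - β) - φ α)) -
        Real.cos β * chordVariation φ α β) 0 := by
  have h0 := chordRatio_circle_ne_zero φ α hβ
  have hq := hasDerivAt_chordRatio hφ α β
  have hre := re_div_chordRatio hφ.continuous α hβ
  have hl := hasDerivAt_log_norm hq h0
  rw [hre] at hl
  have hc := (Complex.conjCLE : ℂ →L[ℝ] ℂ).hasFDerivAt.comp_hasDerivAt (0 : ℝ) hq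
  have hX := (hasDerivAt_exp_angleIncrement φ α β).mul (hc.div hq h0)
  have hR := Complex.reCLM.hasFDerivAt.comp_hasDerivAt (0 : ℝ) hX
  set q₁ := ∫ t in (0 : ℝ)..1, Complex.exp (Complex.I * ((-(β * t) : ℝ) : ℂ)) *
        (Complex.I * ((φ (α - β * t) - φ α : ℝ) : ℂ))
  have hzero : (Complex.exp (Complex.I * ((-β : ℝ) : ℂ)) *
      (Complex.I * ((φ (α - β) - φ α : ℝ) : ℂ)) *
        (starRingEnd ℂ (chordRatio φ ((0, α), β)) / chordRatio φ ((0, α), β)) +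
      Complex.exp (Complex.I * ((-β : ℝ) : ℂ)) *
        ((starRingEnd ℂ q₁ * chordRatio φ ((0, α), β) -
          starRingEnd ℂ (chordRatio φ ((0, α), β)) * q₁) / chordRatio φ ((0, α), β) ^ 2)).re =
              0 := by
    have hc0 : starRingEnd ℂ (chordRatio φ ((0, α), β)) ≠ 0 :=
      (map_ne_zero (starRingEnd ℂ)).2 h0
    have : ∀ e c q d : ℂ, c ≠ 0 → q ≠ 0 → e * (c / q) = 1 →
        e * d * (c / q) + e * ((starRingEnd ℂ q₁ * q - c * q₁) / q ^ 2) =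
          d + starRingEnd ℂ q₁ / c - q₁ / q := fun e c q d hc hq h => by
      have he : e = q / c := by
        field_simp at h
        field_simp
        exact h
      subst he
      field_simp
      ring
    rw [this _ _ _ _ hc0 h0 (exp_mul_conj_chordRatio_circle φ α hβ), ← map_div₀, Complex.sub_re,
        Complex.add_re, Complex.conj_re]
    simp
  have hR' := hR.congr_deriv (show _ = (0 : ℝ) by rw [angleIncrement_circle]; exact hzero)
  have h := ((hl.const_sub (1 / 2 - Real.log R)).mul (hasDerivAt_cos_angleIncrement φ α β)).sub
    (hR'.const_mul (1 / 2))
  refine h.congr_deriv ?_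
  simp only [angleIncrement_circle, Real.cos_neg, norm_chordRatio_circle φ α hβ]
  ring

/-! ### Layer potentials and the linearized normal speed -/

/-- The single-layer potential of density `g` against the normal-normal Stokes kernel, with the
logarithmic singularity split off. -/
noncomputable def layerPotential (R : ℝ) (φ : ℝ → ℝ) (g : (ℝ × ℝ) × ℝ → ℝ) (p : ℝ × ℝ) : ℝ :=
  (∫ β in (-Real.pi)..Real.pi, (-Real.log β) • (g (p, β) * Real.cos (angleIncrement φ (p, β)))) +
    ∫ β in (-Real.pi)..Real.pi, (1 : ℝ) • (g (p, β) * regularKernel R φ (p, β))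

/-- The first variation of `4 π / γ` times the normal speed at the circle. -/
noncomputable def linearSpeed (R : ℝ) (φ : ℝ → ℝ) (α : ℝ) : ℝ :=
  ∫ β in (-Real.pi)..Real.pi,
    ((1 / 2 - Real.log R - logChord β) *
      (Real.sin β * (φ (α - β) - φ α) + Real.cos β * deriv φ (α - β)) -
    1 / 2 * deriv φ (α - β) - Real.cos β * chordVariation φ α β)

theorem intervalIntegrable_neg_log (a b : ℝ) :
    IntervalIntegrable (fun β => -Real.log β) volume a b :=
  intervalIntegrable_log'.neg

theorem uIcc_neg_pi_pi : Set.uIcc (-Real.pi) Real.pi = Set.Icc (-Real.pi) Real.pi :=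
  Set.uIcc_of_le (by linarith [Real.pi_pos])

section

variable {R : ℝ} {φ : ℝ → ℝ} {g : (ℝ × ℝ) × ℝ → ℝ} {p : ℝ × ℝ}

theorem contDiffAt_layerPotential (R : ℝ) {n : ℕ} (hφ : ContDiff ℝ n φ) (hg : ContDiff ℝ n g)
    (hq : ∀ β ∈ Set.Icc (-Real.pi) Real.pi, chordRatio φ (p, β) ≠ 0) :
    ContDiffAt ℝ n (layerPotential R φ g) p := by
  refine ContDiffAt.add ?_ ?_
  · exact contDiffAt_integral_smul (intervalIntegrable_neg_log _ _) n
      (f := fun x => g x * Real.cos (angleIncrement φ x))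
      fun β _ => (hg.mul (contDiff_angleIncrement hφ).cos).contDiffAt
  · exact contDiffAt_integral_smul (by simp) n (w := fun _ => 1)
      (f := fun x => g x * regularKernel R φ x)
      fun β hβ => hg.contDiffAt.mul (contDiffAt_regularKernel R hφ (hq β (uIcc_neg_pi_pi ▸ hβ)))

theorem continuousOn_regularKernel (R : ℝ) (hφ : Continuous φ)
    (hq : ∀ β ∈ Set.Icc (-Real.pi) Real.pi, chordRatio φ (p, β) ≠ 0) :
    ContinuousOn (fun β => regularKernel R φ (p, β)) (Set.uIcc (-Real.pi) Real.pi) :=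
  fun β hβ => (ContinuousAt.comp (f := fun β : ℝ => (p, β))
    (contDiffAt_regularKernel (n := 0) R (by exact_mod_cast contDiff_zero.2 hφ)
      (hq β (uIcc_neg_pi_pi ▸ hβ))).continuousAt (by fun_prop)).continuousWithinAt

theorem continuous_angleIncrement (hφ : Continuous φ) : Continuous (angleIncrement φ) :=
  (contDiff_angleIncrement (n := 0) (by exact_mod_cast contDiff_zero.2 hφ)).continuous

theorem layerPotential_eq (R : ℝ) (hφ : Continuous φ) (hg : Continuous g)
    (hq : ∀ β ∈ Set.Icc (-Real.pi) Real.pi, chordRatio φ (p, β) ≠ 0) :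
    IntervalIntegrable (fun β => g (p, β) * (-Real.log β * Real.cos (angleIncrement φ (p, β)) +
      regularKernel R φ (p, β))) volume (-Real.pi) Real.pi ∧
    layerPotential R φ g p = ∫ β in (-Real.pi)..Real.pi,
      g (p, β) * (-Real.log β * Real.cos (angleIncrement φ (p, β)) +
        regularKernel R φ (p, β)) := by
  have ha := continuous_angleIncrement hφ
  have h1 : IntervalIntegrable (fun β => (-Real.log β) •
      (g (p, β) * Real.cos (angleIncrement φ (p, β)))) volume (-Real.pi) Real.pi :=
    (intervalIntegrable_neg_log _ _).smul_continuousOn (by fun_prop)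
  have h2 : IntervalIntegrable (fun β => (1 : ℝ) • (g (p, β) * regularKernel R φ (p, β))) volume
      (-Real.pi) Real.pi := by
    simp only [one_smul]
    exact (ContinuousOn.mul (by fun_prop) (continuousOn_regularKernel R hφ hq)).intervalIntegrable
  have e : ∀ β, g (p, β) * (-Real.log β * Real.cos (angleIncrement φ (p, β)) +
      regularKernel R φ (p, β)) = (-Real.log β) •
      (g (p, β) * Real.cos (angleIncrement φ (p, β))) +
        (1 : ℝ) • (g (p, β) * regularKernel R φ (p, β)) := fun β => by
    simp only [smul_eq_mul]
    ring
  simp only [e]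
  exact ⟨h1.add h2, by rw [intervalIntegral.integral_add h1 h2, layerPotential]⟩

theorem log_add_log_sinc {β : ℝ} (hβ : β ∈ Set.Icc (-Real.pi) Real.pi) (h0 : β ≠ 0) :
    Real.log β + Real.log (Real.sinc (β / 2)) = logChord β := by
  have hs := sinc_half_pos hβ
  rw [← Real.log_mul h0 hs.ne', logChord, Real.sinc_of_ne_zero (div_ne_zero h0 two_ne_zero)]
  congr 1
  field_simp

theorem regularKernel_circle (R : ℝ) (φ : ℝ → ℝ) (α : ℝ) {β : ℝ}
    (hβ : β ∈ Set.Icc (-Real.pi) Real.pi) :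
    regularKernel R φ ((0, α), β) =
      (1 / 2 - Real.log R - Real.log (Real.sinc (β / 2))) * Real.cos β - 1 / 2 := by
  rw [regularKernel, angleIncrement_circle, exp_mul_conj_chordRatio_circle φ α hβ,
      norm_chordRatio_circle φ α hβ, Real.cos_neg]
  simp

theorem integral_congr_neg_pi_pi {E : Type} [NormedAddCommGroup E] [NormedSpace ℝ E] {f h : ℝ → E}
    (H : ∀ β ∈ Set.Icc (-Real.pi) Real.pi, β ≠ 0 → f β = h β) :
    ∫ β in (-Real.pi)..Real.pi, f β = ∫ β in (-Real.pi)..Real.pi, h β := by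
  refine intervalIntegral.integral_congr_ae ?_
  filter_upwards [compl_mem_ae_iff.2 (measure_singleton (0 : ℝ))] with β hβ hβI
  exact H β (uIcc_neg_pi_pi ▸ Set.uIoc_subset_uIcc hβI) hβ

/-- The circle has no normal motion: the logarithmic part contributes π, the constant -1/2
contributes -π, and the multiple of cos β integrates to 0. -/
theorem layerPotential_circle (R : ℝ) (hφ : Continuous φ) (α : ℝ) :
    layerPotential R φ (fun _ => 1) (0, α) = 0 := by
  rw [(layerPotential_eq R hφ continuous_const fun β hβ => chordRatio_circle_ne_zero φ α hβ).2]
  have hl : IntervalIntegrable (fun β => logChord β * Real.cos ((1 : ℕ) * β)) volume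
      (-Real.pi) Real.pi :=
    (intervalIntegrable_logChord _ _).mul_continuousOn (by fun_prop)
  have hc : IntervalIntegrable (fun β => (1 / 2 - Real.log R) * Real.cos β - 1 / 2) volume
      (-Real.pi) Real.pi := Continuous.intervalIntegrable (by fun_prop) _ _
  calc _ = ∫ β in (-Real.pi)..Real.pi, (((1 / 2 - Real.log R) * Real.cos β - 1 / 2) -
        logChord β * Real.cos ((1 : ℕ) * β)) := by
        refine integral_congr_neg_pi_pi fun β hβ h0 => ?_
        rw [regularKernel_circle R φ α hβ, angleIncrement_circle, Real.cos_neg,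
          ← log_add_log_sinc hβ h0]
        push_cast
        ring_nf
    _ = 0 := by
        rw [intervalIntegral.integral_sub hc hl, integral_logChord_mul_cos one_ne_zero,
          intervalIntegral.integral_sub (Continuous.intervalIntegrable (by fun_prop) _ _)
            (by simp), intervalIntegral.integral_const_mul, integral_cos]
        simp
        ring

theorem hasDerivAt_layerPotential (R : ℝ) (hφ : ContDiff ℝ 1 φ) (α : ℝ) :
    HasDerivAt (fun ε => layerPotential R φ (fun _ => 1) (ε, α))
      ((∫ β in (-Real.pi)..Real.pi, (-Real.log β) • (Real.sin β * (φ (α - β) - φ α))) +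
        ∫ β in (-Real.pi)..Real.pi, (1 : ℝ) •
          ((1 / 2 - Real.log R - Real.log (Real.sinc (β / 2))) * (Real.sin β * (φ (α - β) - φ α)) -
            Real.cos β * chordVariation φ α β)) 0 := by
  simp only [layerPotential, one_mul]
  have hm : ContDiff ℝ 1 fun z : ℝ × ℝ => ((z.1, α), z.2) := by fun_prop
  refine HasDerivAt.add ?_ ?_
  · exact hasDerivAt_integral_smul_of_contDiffAt (intervalIntegrable_neg_log _ _)
      (f := fun z : ℝ × ℝ => Real.cos (angleIncrement φ ((z.1, α), z.2)))
      (fun β _ => ((contDiff_angleIncrement (n := 1) hφ).comp hm).cos.contDiffAt)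
      fun β _ => hasDerivAt_cos_angleIncrement φ α β
  · exact hasDerivAt_integral_smul_of_contDiffAt (w := fun _ => 1) (by simp)
      (f := fun z : ℝ × ℝ => regularKernel R φ ((z.1, α), z.2))
      (fun β hβ => ContDiffAt.comp (0, β) (contDiffAt_regularKernel (n := 1) R hφ
        (chordRatio_circle_ne_zero φ α (uIcc_neg_pi_pi ▸ hβ))) hm.contDiffAt)
      fun β hβ => hasDerivAt_regularKernel R hφ α (uIcc_neg_pi_pi ▸ hβ)

theorem continuousOn_log_sinc :
    ContinuousOn (fun β => Real.log (Real.sinc (β / 2))) (Set.uIcc (-Real.pi) Real.pi) :=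
  ContinuousOn.log (Real.continuous_sinc.comp (by fun_prop)).continuousOn fun β hβ =>
    (sinc_half_pos (uIcc_neg_pi_pi ▸ hβ)).ne'

theorem continuousOn_chordVariation (hφ : ContDiff ℝ 1 φ) (α : ℝ) :
    ContinuousOn (chordVariation φ α) (Set.uIcc (-Real.pi) Real.pi) := by
  have hc : Continuous fun β : ℝ =>
      ∫ t in (0 : ℝ)..1, Real.sin (β * (t - 1 / 2)) * (φ (α - β * t) - φ α) := by
    have := hφ.continuous
    exact intervalIntegral.continuous_parametric_intervalIntegral_of_continuous' (by fun_prop) _ _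
  refine (hc.continuousOn.div (Real.continuous_sinc.comp
    (by fun_prop : Continuous fun β : ℝ => β / 2)).continuousOn
    fun β hβ => (sinc_half_pos (uIcc_neg_pi_pi ▸ hβ)).ne').congr fun β hβ => ?_
  rw [chordVariation]
  simp only [Pi.div_apply]
  rw [← intervalIntegral.integral_div]
  refine intervalIntegral.integral_congr fun t _ => ?_
  simp only [Function.comp]
  ring

/-- The two first-order effects are the variation of the kernel with unit density and the variation
φ' of the density against the kernel of the circle. Together log|β| and log sinc(β/2) recombine into
`logChord`. -/
theorem deriv_layerPotential_add (R : ℝ) (hφ : ContDiff ℝ 1 φ) (α : ℝ) :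
    deriv (fun ε => layerPotential R φ (fun _ => 1) (ε, α)) 0 +
      layerPotential R φ (fun x => deriv φ (x.1.2 - x.2)) (0, α) = linearSpeed R φ α := by
  have hd : Continuous (deriv φ) := hφ.continuous_deriv le_rfl
  have hc := hφ.continuous
  have hv := continuousOn_chordVariation hφ α
  have hl := continuousOn_log_sinc
  have h1 : IntervalIntegrable (fun β => (-Real.log β) • (Real.sin β * (φ (α - β) - φ α)))
      volume (-Real.pi) Real.pi :=
    (intervalIntegrable_neg_log _ _).smul_continuousOn (by fun_prop)
  have h2 : IntervalIntegrable (fun β => (1 : ℝ) •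
      ((1 / 2 - Real.log R - Real.log (Real.sinc (β / 2))) * (Real.sin β * (φ (α - β) - φ α)) -
        Real.cos β * chordVariation φ α β)) volume (-Real.pi) Real.pi := by
    simp only [one_smul]
    exact ContinuousOn.intervalIntegrable (((continuousOn_const.sub hl).mul (by fun_prop)).sub
      (ContinuousOn.mul (by fun_prop) hv))
  obtain ⟨h3, e3⟩ := layerPotential_eq (g := fun x => deriv φ (x.1.2 - x.2)) R hc (by fun_prop)
    fun β hβ => chordRatio_circle_ne_zero φ α hβ
  rw [(hasDerivAt_layerPotential R hφ α).deriv, e3, ← intervalIntegral.integral_add h1 h2,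
    ← intervalIntegral.integral_add (h1.add h2) h3, linearSpeed]
  refine integral_congr_neg_pi_pi fun β hβ h0 => ?_
  rw [regularKernel_circle R φ α hβ, angleIncrement_circle, Real.cos_neg,
          ← log_add_log_sinc hβ h0]
  simp only [smul_eq_mul]
  ring

end

theorem normalSpeed_eq_layerPotential {θ : ℝ → ℝ} (hθ : ContDiff ℝ 1 θ) (γ : ℝ) {L : ℝ} (hL : 0 < L)
    {ε α : ℝ}
    (hq : ∀ β ∈ Set.Icc (-Real.pi) Real.pi, chordRatio (fluctuation θ) ((ε, α), β) ≠ 0) :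
    normalSpeed γ L (perturbed θ ε) α = γ / (4 * Real.pi) *
      (layerPotential (L / (2 * Real.pi)) (fluctuation θ) (fun _ => 1) (ε, α) +
        ε * layerPotential (L / (2 * Real.pi)) (fluctuation θ)
          (fun x => deriv (fluctuation θ) (x.1.2 - x.2)) (ε, α)) := by
  have hφ := contDiff_fluctuation (n := 1) hθ
  have hd : Continuous (deriv (fluctuation θ)) := hφ.continuous_deriv le_rfl
  obtain ⟨h1, e1⟩ := layerPotential_eq (g := fun _ => 1) (L / (2 * Real.pi)) hφ.continuous
    (by fun_prop) hq
  obtain ⟨h2, e2⟩ := layerPotential_eq (g := fun x => deriv (fluctuation θ) (x.1.2 - x.2))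
    (L / (2 * Real.pi)) hφ.continuous (by fun_prop) hq
  rw [normalSpeed_perturbed hθ γ hL hq, e1, e2, ← intervalIntegral.integral_const_mul ε,
    ← intervalIntegral.integral_add h1 (h2.const_mul _)]
  refine congrArg _ (intervalIntegral.integral_congr fun β _ => ?_)
  ring

end StokesInterface

/-! ### Factoring ε out of the normal speed and of the evolution equation -/

/-- Hadamard's lemma: a `C²` function that vanishes for `ε = 0` is `ε` times a `C¹` function. -/
theorem exists_contDiffAt_eq_fst_mul {A : ℝ × ℝ → ℝ} {r : ℝ}
    (hA : ∀ p : ℝ × ℝ, |p.1| < r → ContDiffAt ℝ 2 A p) (h0 : ∀ α, A (0, α) = 0) :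
    ∃ M : ℝ × ℝ → ℝ, (∀ p : ℝ × ℝ, |p.1| < r → ContDiffAt ℝ 1 M p ∧ A p = p.1 * M p) ∧
      ∀ α, 0 < r → M (0, α) = deriv (fun ε => A (ε, α)) 0 := by
  have hmem : ∀ {p : ℝ × ℝ} {t : ℝ}, |p.1| < r → t ∈ Set.uIcc (0 : ℝ) 1 → |t * p.1| < r :=
    fun {p t} hp ht => by
      rw [Set.uIcc_of_le zero_le_one] at ht
      rw [abs_mul, abs_of_nonneg ht.1]
      exact lt_of_le_of_lt (mul_le_of_le_one_left (abs_nonneg _) ht.2) hp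
  have hline : ∀ {p : ℝ × ℝ}, |p.1| < r →
      HasDerivAt (fun ε => A (ε, p.2)) (fderiv ℝ A p (1, 0)) p.1 := fun {p} hp => by
    have h1 : HasFDerivAt A (fderiv ℝ A p) (p.1, p.2) :=
      ((hA p hp).differentiableAt two_ne_zero).hasFDerivAt
    exact (h1.comp p.1 (hasFDerivAt_prodMk_left p.1 p.2)).hasDerivAt.congr_deriv (by simp)
  have hD : ∀ p : ℝ × ℝ, |p.1| < r → ContDiffAt ℝ 1 (fun p => fderiv ℝ A p (1, 0)) p :=
    fun p hp => ((hA p hp).fderiv_right (m := 1) (by norm_num)).clm_apply contDiffAt_const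
  have hsc : ∀ p : ℝ × ℝ, |p.1| < r → ∀ t ∈ Set.uIcc (0 : ℝ) 1,
      ContDiffAt ℝ 1 (fun x : (ℝ × ℝ) × ℝ => fderiv ℝ A (x.2 * x.1.1, x.1.2) (1, 0)) (p, t) :=
    fun p hp t ht => ContDiffAt.comp (p, t)
      (f := fun x : (ℝ × ℝ) × ℝ => (x.2 * x.1.1, x.1.2))
      (hD (t * p.1, p.2) (hmem hp ht)) (by fun_prop)
  refine ⟨fun p => ∫ t in (0 : ℝ)..1, fderiv ℝ A (t * p.1, p.2) (1, 0),
    fun p hp => ⟨?_, ?_⟩, fun α hr => ?_⟩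
  · have := contDiffAt_integral_smul (a := 0) (b := 1) (w := fun _ => 1) (by simp) 1
      (f := fun x : (ℝ × ℝ) × ℝ => fderiv ℝ A (x.2 * x.1.1, x.1.2) (1, 0)) (hsc p hp)
    simp only [one_smul] at this
    exact this
  -- The fundamental theorem of calculus along the segment from (0, α) to (ε, α).
  · have h := integral_eq_sub_of_hasDerivAt (a := 0) (b := 1)
      (f := fun t : ℝ => A (t * p.1, p.2)) (f' := fun t => p.1 * fderiv ℝ A (t * p.1, p.2) (1, 0))
      (fun t ht => ?_) ?_
    · rw [intervalIntegral.integral_const_mul] at h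
      simp only [one_mul, zero_mul, h0, sub_zero] at h
      exact h.symm
    · exact (HasDerivAt.comp t (h₂ := fun ε => A (ε, p.2)) (h := fun t => t * p.1)
        (hline (p := (t * p.1, p.2)) (hmem hp ht))
        ((hasDerivAt_id' t).mul_const p.1)).congr_deriv (by ring)
    · refine (ContinuousOn.mul continuousOn_const fun t ht => ?_).intervalIntegrable
      exact (ContinuousAt.comp (f := fun t : ℝ => (p, t)) (hsc p hp t ht).continuousAt
        (by fun_prop)).continuousWithinAt
  · have := (hline (p := (0, α)) (by simpa using hr)).deriv
    simp [this]

/-- The difference quotient at 0 is g itself, so continuity of g is enough. -/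
theorem hasDerivAt_mul_self_zero {g f : ℝ → ℝ} (hg : ContinuousAt g 0)
    (hf : ∀ᶠ ε in 𝓝 0, f ε = ε * g ε) : HasDerivAt f (g 0) 0 := by
  have h : HasDerivAt (fun ε => ε * g ε) (g 0) 0 := by
    rw [hasDerivAt_iff_tendsto_slope]
    refine (hg.tendsto.mono_left nhdsWithin_le_nhds).congr' ?_
    filter_upwards [self_mem_nhdsWithin] with ε hε
    have : ε ≠ 0 := hε
    simp [slope_def_field, this]
  exact h.congr_of_eventuallyEq hf

namespace StokesInterface

/-- The variation of `(L / 2π) θ_t` at the circle, for the variation `V` of the normal speed. -/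
noncomputable def circleVariation (V : ℝ → ℝ) (α : ℝ) : ℝ :=
  deriv V α + ((∫ η in (0 : ℝ)..α, V η) -
    (α / (2 * Real.pi)) * ∫ η in (-Real.pi)..Real.pi, V η)

/-- Every term of the right-hand side is linear in U = εN, so ε factors out and no mixed second
derivative of U is needed, only the continuity in ε of N and of its derivative in α. -/
theorem hasDerivAt_thetaRHS {θ : ℝ → ℝ} (hθ : ContDiff ℝ 1 θ) (γ L : ℝ) {r : ℝ} (hr : 0 < r)
    {N : ℝ × ℝ → ℝ} (hN : ∀ p : ℝ × ℝ, |p.1| < r → ContDiffAt ℝ 1 N p)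
    (hU : ∀ p : ℝ × ℝ, |p.1| < r → normalSpeed γ L (perturbed θ p.1) p.2 = p.1 * N p) (α : ℝ) :
    HasDerivAt (fun ε => thetaRHS γ L (perturbed θ ε) α)
      (2 * Real.pi / L * circleVariation (fun η => N (0, η)) α) 0 := by
  set φ := fluctuation θ with hφ
  have hd : Continuous (deriv φ) := (contDiff_fluctuation (n := 1) hθ).continuous_deriv le_rfl
  have hIoo : ∀ᶠ ε in 𝓝 (0 : ℝ), |ε| < r := by
    simpa using (continuous_abs.tendsto (0 : ℝ)).eventually (gt_mem_nhds (by simpa using hr))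
  have hline : ∀ ε η, |ε| < r → HasDerivAt (fun η => N (ε, η)) (fderiv ℝ N (ε, η) (0, 1)) η :=
    fun ε η hε => ((((hN (ε, η) hε).differentiableAt one_ne_zero).hasFDerivAt.comp η
      (hasFDerivAt_prodMk_right ε η)).hasDerivAt).congr_deriv (by simp)
  have hJ : ∀ a b : ℝ, ContinuousAt
      (fun ε => ∫ η in a..b, (1 + ε * deriv φ η) * N (ε, η)) 0 := fun a b => by
    have := continuousAt_integral_smul (a := a) (b := b) (w := fun _ => 1) (by simp)
      (f := fun x : ℝ × ℝ => (1 + x.1 * deriv φ x.2) * N x) (p₀ := 0) fun β _ => ?_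
    · simpa only [one_smul] using this
    · have h1 : ∀ᶠ z : ℝ × ℝ in 𝓝 (0, β), |z.1| < r :=
        (continuous_fst.tendsto ((0 : ℝ), β)).eventually hIoo
      filter_upwards [h1] with z hz
      exact ContinuousAt.mul (by fun_prop) (hN z hz).continuousAt
  have hg : ContinuousAt (fun ε => 2 * Real.pi / L * (fderiv ℝ N (ε, α) (0, 1) +
      ((∫ η in (0 : ℝ)..α, (1 + ε * deriv φ η) * N (ε, η)) -
        (α / (2 * Real.pi)) * ∫ η in (-Real.pi)..Real.pi, (1 + ε * deriv φ η) * N (ε, η)) *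
          (1 + ε * deriv φ α))) 0 := by
    have h1 : ContinuousAt (fun ε => fderiv ℝ N (ε, α) (0, 1)) 0 :=
      (ContinuousAt.comp (f := fun ε : ℝ => (ε, α))
        ((hN (0, α) (by simpa using hr)).continuousAt_fderiv one_ne_zero)
        (by fun_prop)).clm_apply continuousAt_const
    exact continuousAt_const.mul (h1.add (((hJ _ _).sub (continuousAt_const.mul (hJ _ _))).mul
      (by fun_prop)))
  refine (hasDerivAt_mul_self_zero hg ?_).congr_deriv ?_
  · filter_upwards [hIoo] with ε hε
    have e : normalSpeed γ L (perturbed θ ε) = fun η => ε * N (ε, η) :=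
      funext fun η => hU (ε, η) hε
    have e2 : ∀ η, (1 + ε * deriv φ η) * (ε * N (ε, η)) =
        ε * ((1 + ε * deriv φ η) * N (ε, η)) := fun η => by ring
    rw [thetaRHS, tangentialSpeed, e]
    simp only [deriv_perturbed (hθ.differentiable one_ne_zero), ← hφ, e2,
      intervalIntegral.integral_const_mul]
    rw [((hline ε α hε).const_mul ε).deriv]
    ring
  · rw [circleVariation, (hline 0 α (by simpa using hr)).deriv]
    simp

/-- Regularity is balanced: the potential of density 1 is C² and loses one derivative in Hadamard's
lemma, while the potential of density φ' is only C¹ but already carries the factor ε. -/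
theorem exists_normalSpeed_eq {θ : ℝ → ℝ} (hθ : ContDiff ℝ 2 θ)
    (hper : Function.Periodic θ (2 * Real.pi)) (γ : ℝ) {L : ℝ} (hL : 0 < L) :
    ∃ r : ℝ, 0 < r ∧
      (∀ ε : ℝ, |ε| < r → ∀ α : ℝ, ∀ β ∈ Set.Icc (-Real.pi) Real.pi,
        chordRatio (fluctuation θ) ((ε, α), β) ≠ 0) ∧
      ∃ N : ℝ × ℝ → ℝ, (∀ p : ℝ × ℝ, |p.1| < r → ContDiffAt ℝ 1 N p) ∧
        (∀ p : ℝ × ℝ, |p.1| < r → normalSpeed γ L (perturbed θ p.1) p.2 = p.1 * N p) ∧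
        ∀ α, N (0, α) =
          γ / (4 * Real.pi) * linearSpeed (L / (2 * Real.pi)) (fluctuation θ) α := by
  have hφ := contDiff_fluctuation (n := 2) hθ
  have hφ1 : ContDiff ℝ 1 (fluctuation θ) := contDiff_fluctuation (n := 1) (hθ.of_le (by norm_num))
  have hd : ContDiff ℝ 1 (deriv (fluctuation θ)) :=
    hφ.deriv' (n := 1)
  obtain ⟨r, hr, hq⟩ := Metric.eventually_nhds_iff.1
    (eventually_chordRatio_ne_zero hφ.continuous (periodic_fluctuation hper))
  simp only [Real.dist_eq, sub_zero] at hq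
  have hq : ∀ ε : ℝ, |ε| < r → ∀ α : ℝ, ∀ β ∈ Set.Icc (-Real.pi) Real.pi,
        chordRatio (fluctuation θ) ((ε, α), β) ≠ 0 := fun ε hε => hq hε
  obtain ⟨M, hM, hM0⟩ := exists_contDiffAt_eq_fst_mul (r := r)
    (A := layerPotential (L / (2 * Real.pi)) (fluctuation θ) (fun _ => 1))
    (fun p hp => contDiffAt_layerPotential (n := 2) _ hφ contDiff_const (hq p.1 hp p.2))
    fun α => layerPotential_circle _ hφ.continuous α
  refine ⟨r, hr, hq, fun p => γ / (4 * Real.pi) * (M p + layerPotential (L / (2 * Real.pi))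
    (fluctuation θ) (fun x => deriv (fluctuation θ) (x.1.2 - x.2)) p),
    fun p hp => ?_, fun p hp => ?_, fun α => ?_⟩
  · exact contDiffAt_const.mul ((hM p hp).1.add (contDiffAt_layerPotential (n := 1) _ hφ1
      (hd.comp (by fun_prop)) (hq p.1 hp p.2)))
  · rw [normalSpeed_eq_layerPotential (hθ.of_le (by norm_num)) γ hL (hq p.1 hp p.2), (hM p hp).2]
    ring
  · beta_reduce
    rw [hM0 α hr, deriv_layerPotential_add _ hφ1]

/-! ### Rules for Fourier modes -/

theorem fourierMode_add {f g : ℝ → ℝ} (hf : Continuous f) (hg : Continuous g) (k : ℤ) :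
    fourierMode (fun α => f α + g α) k = fourierMode f k + fourierMode g k := by
  simp only [fourierMode]
  rw [← mul_add, ← intervalIntegral.integral_add (Continuous.intervalIntegrable (by fun_prop) _ _)
    (Continuous.intervalIntegrable (by fun_prop) _ _)]
  simp only [Complex.ofReal_add, add_mul]

theorem fourierMode_const_mul (c : ℝ) (f : ℝ → ℝ) (k : ℤ) :
    fourierMode (fun α => c * f α) k = c * fourierMode f k := by
  simp only [fourierMode, Complex.ofReal_mul, mul_assoc, intervalIntegral.integral_const_mul]
  ring

theorem fourierMode_sub {f g : ℝ → ℝ} (hf : Continuous f) (hg : Continuous g) (k : ℤ) :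
    fourierMode (fun α => f α - g α) k = fourierMode f k - fourierMode g k := by
  have h := fourierMode_add hf (hg.const_mul (-1)) k
  rw [fourierMode_const_mul] at h
  simp only [neg_mul, one_mul, ← sub_eq_add_neg] at h
  rw [h]
  push_cast
  ring

theorem fourierMode_const (c : ℝ) {k : ℤ} (hk : k ≠ 0) : fourierMode (fun _ => c) k = 0 := by
  have hk' : (k : ℂ) ≠ 0 := by exact_mod_cast hk
  have e : ∀ α : ℝ, Complex.exp (-(Complex.I * (k : ℂ) * (α : ℂ))) =
      Complex.exp (-(Complex.I * k) * α) := fun α => by ring_nf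
  have : ∫ α in (-Real.pi)..Real.pi, Complex.exp (-(Complex.I * (k : ℂ) * (α : ℂ))) = 0 := by
    simp only [e]
    rw [integral_exp_mul_complex (by simpa using hk), div_eq_zero_iff, sub_eq_zero]
    left
    rw [Complex.exp_eq_exp_iff_exists_int]
    exact ⟨-k, by push_cast; ring⟩
  rw [fourierMode, intervalIntegral.integral_const_mul, this, mul_zero, mul_zero]

theorem fourierMode_neg (f : ℝ → ℝ) (k : ℤ) :
    fourierMode f (-k) = starRingEnd ℂ (fourierMode f k) := by
  rw [fourierMode, fourierMode, map_mul, ← intervalIntegral_conj]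
  congr 1
  · simp only [map_div₀, map_mul, map_one, map_ofNat, Complex.conj_ofReal]
  · refine intervalIntegral.integral_congr fun α _ => ?_
    simp only [map_mul, Complex.conj_ofReal, ← Complex.exp_conj, map_neg, Complex.conj_I,
      map_intCast]
    push_cast
    ring_nf

theorem fourierMode_comp_sub {f : ℝ → ℝ} (hper : Function.Periodic f (2 * Real.pi)) (s : ℝ)
    (k : ℤ) : fourierMode (fun α => f (α - s)) k =
      Complex.exp (-(Complex.I * k * s)) * fourierMode f k := by
  set F : ℝ → ℂ := fun α => (f α : ℂ) * Complex.exp (-(Complex.I * (k : ℂ) * (α : ℂ))) with hF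
  have hFp : Function.Periodic F (2 * Real.pi) := fun α => by
    simp only [hF, hper α]
    congr 1
    rw [Complex.exp_eq_exp_iff_exists_int]
    exact ⟨-k, by push_cast; ring⟩
  have e : ∀ α : ℝ, (f (α - s) : ℂ) * Complex.exp (-(Complex.I * (k : ℂ) * (α : ℂ))) =
      Complex.exp (-(Complex.I * k * s)) * F (α - s) := fun α => by
    simp only [hF]
    rw [mul_left_comm, ← Complex.exp_add]
    congr 2
    push_cast
    ring
  have h2 : ∫ α in (-Real.pi - s)..(Real.pi - s), F α = ∫ α in (-Real.pi)..Real.pi, F α := by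
    have h := hFp.intervalIntegral_add_eq (-Real.pi - s) (-Real.pi)
    rw [show -Real.pi - s + 2 * Real.pi = Real.pi - s by ring,
      show -Real.pi + 2 * Real.pi = Real.pi by ring] at h
    exact h
  simp only [fourierMode, e]
  rw [intervalIntegral.integral_const_mul, intervalIntegral.integral_comp_sub_right F, h2]
  ring

theorem fourierMode_deriv {f f' : ℝ → ℝ} (hf : ∀ α, HasDerivAt f (f' α) α) (hf' : Continuous f')
    (hper : Function.Periodic f (2 * Real.pi)) (k : ℤ) :
    fourierMode f' k = Complex.I * k * fourierMode f k := by
  have hfc : Continuous f := continuous_iff_continuousAt.2 fun α => (hf α).continuousAt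
  have hexp : ∀ α : ℝ, HasDerivAt (fun α : ℝ => Complex.exp (-(Complex.I * (k : ℂ) * (α : ℂ))))
      (Complex.exp (-(Complex.I * (k : ℂ) * (α : ℂ))) * (-(Complex.I * k * 1))) α := fun α =>
    ((((hasDerivAt_id' α).ofReal_comp).const_mul (Complex.I * (k : ℂ))).neg).cexp
  have h := integral_eq_sub_of_hasDerivAt (a := -Real.pi) (b := Real.pi)
    (fun α _ => (hf α).ofReal_comp.mul (hexp α))
    (Continuous.intervalIntegrable (by fun_prop) _ _)
  have e1 : f Real.pi = f (-Real.pi) := by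
    rw [← hper (-Real.pi)]
    ring_nf
  have e2 : Complex.exp (-(Complex.I * (k : ℂ) * (Real.pi : ℂ))) =
      Complex.exp (-(Complex.I * (k : ℂ) * ((-Real.pi : ℝ) : ℂ))) := by
    rw [Complex.exp_eq_exp_iff_exists_int]
    exact ⟨-k, by push_cast; ring⟩
  rw [intervalIntegral.integral_add (Continuous.intervalIntegrable (by fun_prop) _ _)
    (Continuous.intervalIntegrable (by fun_prop) _ _)] at h
  simp only [Pi.mul_apply, e1, e2, sub_self] at h
  have e3 : ∀ α : ℝ, (f α : ℂ) * (Complex.exp (-(Complex.I * (k : ℂ) * (α : ℂ))) *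
      (-(Complex.I * k * 1))) = -(Complex.I * k) *
        ((f α : ℂ) * Complex.exp (-(Complex.I * (k : ℂ) * (α : ℂ)))) := fun α => by ring
  simp only [e3, intervalIntegral.integral_const_mul] at h
  rw [fourierMode, fourierMode]
  linear_combination (1 / (2 * (Real.pi : ℂ))) * h

/-- Fubini: the weight is integrable and the other factor is bounded on the compact rectangle. -/
theorem fourierMode_integral {a b : ℝ} {w : ℝ → ℝ} (hw : IntervalIntegrable w volume a b)
    {g : ℝ → ℝ → ℝ} (hg : Continuous (Function.uncurry g)) (k : ℤ) :
    fourierMode (fun α => ∫ β in a..b, w β * g α β) k =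
      ∫ β in a..b, (w β : ℂ) * fourierMode (fun α => g α β) k := by
  set G : ℝ → ℝ → ℂ := fun α β => (w β : ℂ) * ((g α β : ℂ) *
    Complex.exp (-(Complex.I * (k : ℂ) * (α : ℂ)))) with hG
  have e1 : ∀ α : ℝ, ((∫ β in a..b, w β * g α β : ℝ) : ℂ) *
      Complex.exp (-(Complex.I * (k : ℂ) * (α : ℂ))) = ∫ β in a..b, G α β := fun α => by
    rw [← intervalIntegral.integral_ofReal, ← intervalIntegral.integral_mul_const]
    refine intervalIntegral.integral_congr fun β _ => ?_
    simp only [hG]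
    push_cast
    ring
  have e2 : ∀ β : ℝ, (w β : ℂ) * fourierMode (fun α => g α β) k =
      (1 / (2 * (Real.pi : ℂ))) * ∫ α in (-Real.pi)..Real.pi, G α β := fun β => by
    simp only [hG, fourierMode, intervalIntegral.integral_const_mul]
    ring
  simp only [e2, intervalIntegral.integral_const_mul]
  rw [fourierMode]
  simp only [e1]
  congr 1
  refine MeasureTheory.intervalIntegral_intervalIntegral_swap ?_
  have : IsFiniteMeasure (volume.restrict (Set.uIoc (-Real.pi) Real.pi)) :=
    ⟨by simp [Set.uIoc, Real.volume_Ioc]⟩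
  have hwi : Integrable (fun z : ℝ × ℝ => (w z.2 : ℂ))
      ((volume.restrict (Set.uIoc (-Real.pi) Real.pi)).prod (volume.restrict (Set.uIoc a b))) :=
    Integrable.comp_snd (f := fun β => (w β : ℂ)) (Integrable.ofReal hw.def') _
  have hc : Continuous fun z : ℝ × ℝ =>
      (g z.1 z.2 : ℂ) * Complex.exp (-(Complex.I * (k : ℂ) * (z.1 : ℂ))) := by
    have : Continuous fun z : ℝ × ℝ => g z.1 z.2 := hg
    fun_prop
  obtain ⟨C, hC⟩ := (isCompact_uIcc.prod isCompact_uIcc : IsCompact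
    (Set.uIcc (-Real.pi) Real.pi ×ˢ Set.uIcc a b)).exists_bound_of_continuousOn hc.continuousOn
  rw [IntegrableOn, Measure.volume_eq_prod, ← Measure.prod_restrict]
  refine hwi.mul_bdd (c := C) hc.aestronglyMeasurable ?_
  rw [Measure.prod_restrict]
  refine (ae_restrict_iff' (measurableSet_uIoc.prod measurableSet_uIoc)).2
    (Eventually.of_forall fun z hz => hC z
      ⟨Set.uIoc_subset_uIcc hz.1, Set.uIoc_subset_uIcc hz.2⟩)

/-! ### The multiplier of the linearized normal speed -/

/-- The Fourier multiplier of `chordVariation`. -/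
noncomputable def chordMultiplier (k : ℤ) (β : ℝ) : ℂ :=
  ∫ t in (0 : ℝ)..1, ((Real.sin (β * (t - 1 / 2)) / Real.sinc (β / 2) : ℝ) : ℂ) *
    (Complex.exp (-(Complex.I * k * (β * t : ℝ))) - 1)

theorem chordVariation_eq (φ : ℝ → ℝ) (α β : ℝ) :
    chordVariation φ α β = (Real.sinc (β / 2))⁻¹ *
      ∫ t in (0 : ℝ)..1, Real.sin (β * (t - 1 / 2)) * (φ (α - β * t) - φ α) := by
  rw [chordVariation, ← intervalIntegral.integral_const_mul]
  refine intervalIntegral.integral_congr fun t _ => ?_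
  ring

theorem fourierMode_chordVariation {φ : ℝ → ℝ} (hφ : Continuous φ)
    (hper : Function.Periodic φ (2 * Real.pi)) {k : ℤ} (β : ℝ) :
    fourierMode (fun α => chordVariation φ α β) k = chordMultiplier k β * fourierMode φ k := by
  simp only [chordVariation]
  rw [fourierMode_integral (Continuous.intervalIntegrable (by fun_prop) _ _) (by
    simp only [Function.uncurry_def]
    fun_prop), chordMultiplier, ← intervalIntegral.integral_mul_const]
  refine intervalIntegral.integral_congr fun t _ => ?_
  rw [fourierMode_sub (by fun_prop) hφ, fourierMode_comp_sub hper]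
  ring

theorem fourierMode_linearSpeed (R : ℝ) {φ : ℝ → ℝ} (hφ : ContDiff ℝ 1 φ)
    (hper : Function.Periodic φ (2 * Real.pi)) (k : ℤ) :
    fourierMode (linearSpeed R φ) k =
      ((∫ β in (-Real.pi)..Real.pi, ((1 / 2 - Real.log R - logChord β : ℝ) : ℂ) *
        (Real.sin β * (Complex.exp (-(Complex.I * k * β)) - 1) +
          Real.cos β * (Complex.I * k * Complex.exp (-(Complex.I * k * β))))) -
      (∫ β in (-Real.pi)..Real.pi, 1 / 2 * (Complex.I * k * Complex.exp (-(Complex.I * k * β)))) -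
        ∫ β in (-Real.pi)..Real.pi, Real.cos β * chordMultiplier k β) * fourierMode φ k := by
  have hd : Continuous (deriv φ) := hφ.continuous_deriv le_rfl
  have hc := hφ.continuous
  have hdper : Function.Periodic (deriv φ) (2 * Real.pi) := fun α => by
    rw [← deriv_comp_add_const, funext hper]
  have hder : fourierMode (deriv φ) k = Complex.I * k * fourierMode φ k :=
    fourierMode_deriv (fun α => (hφ.differentiable one_ne_zero α).hasDerivAt) hd hper k
  have hw1 : IntervalIntegrable (fun β => 1 / 2 - Real.log R - logChord β) volume
      (-Real.pi) Real.pi := (by simp : IntervalIntegrable (fun _ => 1 / 2 - Real.log R) volume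
        (-Real.pi) Real.pi).sub (intervalIntegrable_logChord _ _)
  have hw2 : IntervalIntegrable (fun _ => (1 / 2 : ℝ)) volume (-Real.pi) Real.pi := by simp
  -- The factor 1/sinc(β/2) is singular at β = ±2π; placed in the weight it is only needed on [-π,
  -- π], and `g3` is continuous on the whole plane.
  have hw3 : IntervalIntegrable (fun β => Real.cos β * (Real.sinc (β / 2))⁻¹) volume
      (-Real.pi) Real.pi := ContinuousOn.intervalIntegrable (ContinuousOn.mul (by fun_prop)
        (ContinuousOn.inv₀ (Real.continuous_sinc.comp (by fun_prop)).continuousOn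
          fun β hβ => (sinc_half_pos (uIcc_neg_pi_pi ▸ hβ)).ne'))
  set g1 : ℝ → ℝ → ℝ := fun α β =>
    Real.sin β * (φ (α - β) - φ α) + Real.cos β * deriv φ (α - β) with hg1
  set g2 : ℝ → ℝ → ℝ := fun α β => deriv φ (α - β) with hg2
  set g3 : ℝ → ℝ → ℝ := fun α β =>
    ∫ t in (0 : ℝ)..1, Real.sin (β * (t - 1 / 2)) * (φ (α - β * t) - φ α) with hg3
  have hc1 : Continuous (Function.uncurry g1) := by
    simp only [hg1, Function.uncurry_def]
    fun_prop
  have hc2 : Continuous (Function.uncurry g2) := by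
    simp only [hg2, Function.uncurry_def]
    fun_prop
  have hc3 : Continuous (Function.uncurry g3) := by
    simp only [hg3, Function.uncurry_def]
    exact intervalIntegral.continuous_parametric_intervalIntegral_of_continuous' (by
      simp only [Function.uncurry_def]
      fun_prop) _ _
  have hi : ∀ {w : ℝ → ℝ} {g : ℝ → ℝ → ℝ}, IntervalIntegrable w volume (-Real.pi) Real.pi →
      Continuous (Function.uncurry g) → ∀ α,
      IntervalIntegrable (fun β => w β * g α β) volume (-Real.pi) Real.pi :=
    fun {w g} hw hg α => hw.mul_continuousOn
      (hg.comp (by fun_prop : Continuous fun β : ℝ => (α, β))).continuousOn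
  have hI : ∀ {w : ℝ → ℝ} {g : ℝ → ℝ → ℝ}, IntervalIntegrable w volume (-Real.pi) Real.pi →
      Continuous (Function.uncurry g) →
      Continuous fun α => ∫ β in (-Real.pi)..Real.pi, w β * g α β := fun {w g} hw hg =>
    continuous_iff_continuousAt.2 fun α => continuousAt_integral_smul hw
      (f := Function.uncurry g) fun β _ => Eventually.of_forall fun z => hg.continuousAt
  have e : linearSpeed R φ = fun α =>
      (∫ β in (-Real.pi)..Real.pi, (1 / 2 - Real.log R - logChord β) * g1 α β) -
      (∫ β in (-Real.pi)..Real.pi, 1 / 2 * g2 α β) -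
      ∫ β in (-Real.pi)..Real.pi, Real.cos β * (Real.sinc (β / 2))⁻¹ * g3 α β := by
    funext α
    rw [← intervalIntegral.integral_sub (hi hw1 hc1 α) (hi hw2 hc2 α),
      ← intervalIntegral.integral_sub ((hi hw1 hc1 α).sub (hi hw2 hc2 α)) (hi hw3 hc3 α),
      linearSpeed]
    refine intervalIntegral.integral_congr fun β _ => ?_
    simp only [chordVariation_eq, hg3]
    ring
  have hs : Continuous fun α =>
      (∫ β in (-Real.pi)..Real.pi, (1 / 2 - Real.log R - logChord β) * g1 α β) -
      (∫ β in (-Real.pi)..Real.pi, 1 / 2 * g2 α β) := (hI hw1 hc1).sub (hI hw2 hc2)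
  rw [e, fourierMode_sub hs (hI hw3 hc3),
    fourierMode_sub (hI hw1 hc1) (hI hw2 hc2), fourierMode_integral hw1 hc1,
    fourierMode_integral hw2 hc2, fourierMode_integral hw3 hc3, sub_mul, sub_mul,
    ← intervalIntegral.integral_mul_const, ← intervalIntegral.integral_mul_const,
    ← intervalIntegral.integral_mul_const]
  congr 1
  · congr 1
    · refine intervalIntegral.integral_congr fun β _ => ?_
      simp only [hg1]
      rw [fourierMode_add (by fun_prop) (by fun_prop), fourierMode_const_mul,
        fourierMode_const_mul, fourierMode_sub (by fun_prop) hc, fourierMode_comp_sub hper,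
        fourierMode_comp_sub hdper, hder]
      ring
    · refine intervalIntegral.integral_congr fun β _ => ?_
      simp only [hg2]
      rw [fourierMode_comp_sub hdper, hder]
      push_cast
      ring
  · refine intervalIntegral.integral_congr fun β _ => ?_
    rw [mul_assoc, ← fourierMode_chordVariation hc hper]
    simp only [chordVariation_eq, hg3, fourierMode_const_mul]
    push_cast
    ring

theorem exp_neg_I_nat_mul (n : ℕ) (β : ℝ) :
    Complex.exp (-(Complex.I * (n * β : ℝ))) = Complex.exp (-(Complex.I * β)) ^ n := by
  rw [← Complex.exp_nat_mul]
  congr 1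
  push_cast
  ring

theorem integral_exp_neg_I_nat_mul {n : ℕ} (hn : n ≠ 0) {β : ℝ} (h0 : β ≠ 0) :
    ∫ t in (0 : ℝ)..1, Complex.exp (-(Complex.I * (β * t : ℝ))) ^ n =
      (1 - Complex.exp (-(Complex.I * β)) ^ n) / (Complex.I * n * β) := by
  have hβ : (β : ℂ) ≠ 0 := by exact_mod_cast h0
  have hn' : (n : ℂ) ≠ 0 := by exact_mod_cast hn
  have e : ∀ t : ℝ, Complex.exp (-(Complex.I * (β * t : ℝ))) ^ n =
      Complex.exp (-(Complex.I * n * β) * t) := fun t => by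
    rw [← Complex.exp_nat_mul]
    congr 1
    push_cast
    ring
  simp only [e]
  rw [integral_exp_mul_complex (by simp [hn, h0]), ← Complex.exp_nat_mul]
  simp only [Complex.ofReal_zero, mul_zero, Complex.exp_zero, Complex.ofReal_one, mul_one]
  rw [show (n : ℂ) * -(Complex.I * β) = -(Complex.I * n * β) by ring, div_neg, ← neg_div, neg_sub]

theorem integral_sin_mul_sub_half (β : ℝ) :
    ∫ t in (0 : ℝ)..1, Real.sin (β * (t - 1 / 2)) = 0 := by
  have h := intervalIntegral.integral_comp_sub_left (a := 0) (b := 1)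
    (fun t : ℝ => Real.sin (β * (t - 1 / 2))) 1
  have e : ∀ t : ℝ, Real.sin (β * (1 - t - 1 / 2)) = -Real.sin (β * (t - 1 / 2)) := fun t => by
    rw [← Real.sin_neg]
    ring_nf
  simp only [e, intervalIntegral.integral_neg, sub_self, sub_zero] at h
  linarith

/-- With v = e^{-iβt}, the sine factor turns v^{m+1} into v^m and v^{m+2}. Their integrals over t
are (1 - e^{-inβ})/(inβ) for n = m and m + 2, and division by sinc(β/2), proportional to e^{iβ/2}(1
- e^{-iβ})/β, leaves finite geometric sums. For m = 0 the first integral would be 1 instead, which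
is why mode 1 is excluded. -/
theorem chordMultiplier_eq {m : ℕ} (hm : m ≠ 0) {β : ℝ} (hβ : β ∈ Set.Icc (-Real.pi) Real.pi)
    (h0 : β ≠ 0) :
    chordMultiplier (m + 1 : ℕ) β = 1 / (2 * Complex.I) *
      (1 / m * ∑ j ∈ Finset.range m, Complex.exp (-(Complex.I * ((j + 1 : ℕ) * β : ℝ))) -
        1 / (m + 2 : ℕ) *
          ∑ j ∈ Finset.range (m + 2), Complex.exp (-(Complex.I * (j * β : ℝ)))) := by
  have hs := sinc_half_pos hβ
  have hβ0 : (β : ℂ) ≠ 0 := by exact_mod_cast h0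
  have hmC : (m : ℂ) ≠ 0 := by exact_mod_cast hm
  have hm2 : ((m + 2 : ℕ) : ℂ) ≠ 0 := by exact_mod_cast (by omega : m + 2 ≠ 0)
  simp only [exp_neg_I_nat_mul, pow_succ', ← Finset.mul_sum]
  set E := Complex.exp (Complex.I * (β / 2 : ℝ)) with hE
  set F := Complex.exp (-(Complex.I * (β / 2 : ℝ))) with hF
  have hEF : E * F = 1 := by rw [hE, hF, ← Complex.exp_add]; simp
  have hz : Complex.exp (-(Complex.I * β)) = F * F := by
    rw [hF, ← Complex.exp_add]
    congr 1
    push_cast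
    ring
  have hsin : (β : ℂ) * (Real.sinc (β / 2) : ℂ) = (F - E) * Complex.I := by
    have h2 : β * Real.sinc (β / 2) = 2 * Real.sin (β / 2) := by
      rw [Real.sinc_of_ne_zero (div_ne_zero h0 two_ne_zero)]
      field_simp
    rw [← Complex.ofReal_mul, h2]
    push_cast
    rw [Complex.sin, hE, hF]
    push_cast
    ring_nf
  have hsC : (Real.sinc (β / 2) : ℂ) ≠ 0 := by exact_mod_cast hs.ne'
  have hne : F - E ≠ 0 := fun h => by
    rw [h, zero_mul] at hsin
    exact mul_ne_zero hβ0 hsC hsin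
  have hint : ∀ n : ℕ, IntervalIntegrable
      (fun t : ℝ => Complex.exp (-(Complex.I * (β * t : ℝ))) ^ n) volume 0 1 := fun n =>
    Continuous.intervalIntegrable (by fun_prop) _ _
  have e : ∀ t : ℝ, ((Real.sin (β * (t - 1 / 2)) / Real.sinc (β / 2) : ℝ) : ℂ) *
      (Complex.exp (-(Complex.I * ((m + 1 : ℕ) : ℤ) * (β * t : ℝ))) - 1) =
      (Real.sinc (β / 2) : ℂ)⁻¹ * (Complex.I / 2) *
        (E * Complex.exp (-(Complex.I * (β * t : ℝ))) ^ (m + 2) -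
          F * Complex.exp (-(Complex.I * (β * t : ℝ))) ^ m) -
      (Real.sinc (β / 2) : ℂ)⁻¹ * (Real.sin (β * (t - 1 / 2)) : ℂ) := fun t => by
    have h1 : Complex.exp (-(Complex.I * ((m + 1 : ℕ) : ℤ) * (β * t : ℝ))) =
        Complex.exp (-(Complex.I * (β * t : ℝ))) ^ (m + 1) := by
      rw [← Complex.exp_nat_mul]
      congr 1
      push_cast
      ring
    have h2 : (Real.sin (β * (t - 1 / 2)) : ℂ) =
        (Complex.exp (-(Complex.I * (β * t : ℝ))) * E -
          Complex.exp (Complex.I * (β * t : ℝ)) * F) * (Complex.I / 2) := by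
      rw [Complex.ofReal_sin, Complex.sin, hE, hF, ← Complex.exp_add, ← Complex.exp_add]
      push_cast
      ring_nf
    have h3 : Complex.exp (Complex.I * (β * t : ℝ)) * Complex.exp (-(Complex.I * (β * t : ℝ))) =
        1 := by
      rw [← Complex.exp_add]
      simp
    rw [h1, Complex.ofReal_div, h2, div_eq_mul_inv]
    generalize Complex.exp (Complex.I * (β * t : ℝ)) = u at *
    generalize Complex.exp (-(Complex.I * (β * t : ℝ))) = v at *
    linear_combination (-(Real.sinc (β / 2) : ℂ)⁻¹ * (Complex.I / 2) * F * v ^ m) * h3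
  have hg1 := mul_neg_geom_sum (F * F) m
  have hg2 := mul_neg_geom_sum (F * F) (m + 2)
  rw [chordMultiplier]
  simp only [e]
  rw [intervalIntegral.integral_sub
    ((((hint (m + 2)).const_mul E).sub ((hint m).const_mul F)).const_mul _)
    (Continuous.intervalIntegrable (by fun_prop) _ _), intervalIntegral.integral_const_mul,
    intervalIntegral.integral_const_mul,
    intervalIntegral.integral_sub ((hint (m + 2)).const_mul E) ((hint m).const_mul F),
    intervalIntegral.integral_const_mul, intervalIntegral.integral_const_mul,
    integral_exp_neg_I_nat_mul hm h0, integral_exp_neg_I_nat_mul (by omega) h0,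
    intervalIntegral.integral_ofReal, integral_sin_mul_sub_half, hz, ← hg1, ← hg2]
  generalize ∑ i ∈ Finset.range m, (F * F) ^ i = S₁
  generalize ∑ i ∈ Finset.range (m + 2), (F * F) ^ i = S₂
  have hsv : (Real.sinc (β / 2) : ℂ) = (F - E) * Complex.I / β := by
    rw [eq_div_iff hβ0, mul_comm, hsin]
  have h5 : E * ((1 - F * F) * S₂ / (Complex.I * (m + 2 : ℕ) * β)) =
      -(F - E) * S₂ / (Complex.I * (m + 2 : ℕ) * β) := by
    rw [← mul_div_assoc]
    congr 1
    linear_combination (-F * S₂) * hEF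
  have h6 : F * ((1 - F * F) * S₁ / (Complex.I * m * β)) =
      -(F - E) * (F * F * S₁) / (Complex.I * m * β) := by
    rw [← mul_div_assoc]
    congr 1
    linear_combination (-F * S₁) * hEF
  rw [h5, h6, hsv]
  generalize F - E = D at hne
  field_simp
  rw [Complex.ofReal_zero]
  push_cast
  ring

/-- The functions `e^{-inβ}` are moved by trigonometric factors to their neighbours. -/
theorem cos_mul_exp_succ (n : ℕ) (β : ℝ) :
    (Real.cos β : ℂ) * Complex.exp (-(Complex.I * ((n + 1 : ℕ) * β : ℝ))) =
      1 / 2 * (Complex.exp (-(Complex.I * (n * β : ℝ))) +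
        Complex.exp (-(Complex.I * ((n + 2 : ℕ) * β : ℝ)))) := by
  have e1 : -(Complex.I * (n * β : ℝ)) =
    -(Complex.I * ((n + 1 : ℕ) * β : ℝ)) + β * Complex.I := by push_cast; ring
  have e2 : -(Complex.I * ((n + 2 : ℕ) * β : ℝ)) =
    -(Complex.I * ((n + 1 : ℕ) * β : ℝ)) + -β * Complex.I := by push_cast; ring
  rw [e1, e2, Complex.exp_add, Complex.exp_add, Complex.ofReal_cos, Complex.cos]
  ring

theorem sin_mul_exp_succ (n : ℕ) (β : ℝ) :
    (Real.sin β : ℂ) * Complex.exp (-(Complex.I * ((n + 1 : ℕ) * β : ℝ))) =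
      Complex.I / 2 * (Complex.exp (-(Complex.I * ((n + 2 : ℕ) * β : ℝ))) -
        Complex.exp (-(Complex.I * (n * β : ℝ)))) := by
  have e1 : -(Complex.I * (n * β : ℝ)) =
    -(Complex.I * ((n + 1 : ℕ) * β : ℝ)) + β * Complex.I := by push_cast; ring
  have e2 : -(Complex.I * ((n + 2 : ℕ) * β : ℝ)) =
    -(Complex.I * ((n + 1 : ℕ) * β : ℝ)) + -β * Complex.I := by push_cast; ring
  rw [e1, e2, Complex.exp_add, Complex.exp_add, Complex.ofReal_sin, Complex.sin]
  ring

theorem integral_cos_mul_exp (n : ℕ) :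
    ∫ β in (-Real.pi)..Real.pi, (Real.cos β : ℂ) * Complex.exp (-(Complex.I * (n * β : ℝ))) =
      if n = 1 then (Real.pi : ℂ) else 0 := by
  rcases n with _ | n
  · simp only [Nat.cast_zero, zero_mul, Complex.ofReal_zero, mul_zero, neg_zero, Complex.exp_zero,
      mul_one]
    rw [intervalIntegral.integral_ofReal, integral_cos]
    simp
  · simp only [cos_mul_exp_succ, intervalIntegral.integral_const_mul]
    rw [intervalIntegral.integral_add (Continuous.intervalIntegrable (by fun_prop) _ _)
      (Continuous.intervalIntegrable (by fun_prop) _ _), integral_exp_neg_I_mul (n :=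
          n + 2) (by omega)]
    rcases n with _ | n
    · simp
      ring
    · rw [integral_exp_neg_I_mul (by omega)]
      simp

/-- Against cos β only e^{-iβ} survives, with integral π. It is the index j = 0 of the first sum,
present because m ≥ 1, and j = 1 of the second. -/
theorem integral_cos_mul_chordMultiplier {m : ℕ} (hm : m ≠ 0) :
    ∫ β in (-Real.pi)..Real.pi, Real.cos β * chordMultiplier (m + 1 : ℕ) β =
      1 / (2 * Complex.I) * (1 / m * Real.pi - 1 / (m + 2 : ℕ) * Real.pi) := by
  set X : ℕ → ℝ → ℂ := fun n β =>
    (Real.cos β : ℂ) * Complex.exp (-(Complex.I * (n * β : ℝ))) with hX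
  have hi : ∀ n, IntervalIntegrable (X n) volume (-Real.pi) Real.pi := fun n =>
    Continuous.intervalIntegrable (by simp only [hX]; fun_prop) _ _
  have hs1 : IntervalIntegrable (fun β => ∑ j ∈ Finset.range m, X (j + 1) β) volume
      (-Real.pi) Real.pi := Continuous.intervalIntegrable (by simp only [hX]; fun_prop) _ _
  have hs2 : IntervalIntegrable (fun β => ∑ j ∈ Finset.range (m + 2), X j β) volume
      (-Real.pi) Real.pi := Continuous.intervalIntegrable (by simp only [hX]; fun_prop) _ _
  calc _ = ∫ β in (-Real.pi)..Real.pi, 1 / (2 * Complex.I) *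
        (1 / m * ∑ j ∈ Finset.range m, X (j + 1) β -
          1 / (m + 2 : ℕ) * ∑ j ∈ Finset.range (m + 2), X j β) := by
        refine integral_congr_neg_pi_pi fun β hβ h0 => ?_
        rw [chordMultiplier_eq hm hβ h0]
        simp only [hX, ← Finset.mul_sum]
        ring
    _ = _ := by
        rw [intervalIntegral.integral_const_mul, intervalIntegral.integral_sub
          (hs1.const_mul _) (hs2.const_mul _), intervalIntegral.integral_const_mul,
          intervalIntegral.integral_const_mul,
          intervalIntegral.integral_finsetSum fun j _ => hi _,
          intervalIntegral.integral_finsetSum fun j _ => hi _]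
        simp only [hX, integral_cos_mul_exp]
        have h1 : 0 < m := Nat.pos_of_ne_zero hm
        simp [Finset.sum_ite_eq', h1]

/-- The constant integrates to 0 against a nonzero mode, so log R leaves no trace in the multiplier.
-/
theorem integral_sub_logChord_mul_exp (c : ℝ) {n : ℕ} (hn : n ≠ 0) :
    ∫ β in (-Real.pi)..Real.pi, ((c - logChord β : ℝ) : ℂ) *
      Complex.exp (-(Complex.I * (n * β : ℝ))) = Real.pi / n := by
  simp only [Complex.ofReal_sub, sub_mul]
  rw [intervalIntegral.integral_sub (Continuous.intervalIntegrable (by fun_prop) _ _)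
    ((intervalIntegrable_ofReal (intervalIntegrable_logChord _ _)).mul_continuousOn
      (by fun_prop)), intervalIntegral.integral_const_mul, integral_exp_neg_I_mul hn,
    integral_logChord_mul_exp hn]
  ring

/-- The logarithmic kernel meets modes m and m + 2 with coefficients im/2 and i(m+2)/2, which cancel
the decay π/n and give iπ in all. The chord variation adds iπ/(m(m+2)), and 1 + 1/(m(m+2)) =
(m+1)²/(m(m+2)). -/
theorem fourierMode_linearSpeed_nat (R : ℝ) {φ : ℝ → ℝ} (hφ : ContDiff ℝ 1 φ)
    (hper : Function.Periodic φ (2 * Real.pi)) {m : ℕ} (hm : m ≠ 0) :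
    fourierMode (linearSpeed R φ) (m + 1 : ℕ) =
      Complex.I * Real.pi * ((m + 1) ^ 2 / (m * (m + 2))) * fourierMode φ (m + 1 : ℕ) := by
  have hm' : (m : ℂ) ≠ 0 := by exact_mod_cast hm
  have hm2 : (m : ℂ) + 2 ≠ 0 := by exact_mod_cast (by omega : m + 2 ≠ 0)
  set c := 1 / 2 - Real.log R with hc
  have hwi : ∀ n : ℕ, IntervalIntegrable (fun β => ((c - logChord β : ℝ) : ℂ) *
      Complex.exp (-(Complex.I * (n * β : ℝ)))) volume (-Real.pi) Real.pi := fun n =>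
    (intervalIntegrable_ofReal ((by simp : IntervalIntegrable (fun _ => c) volume
      (-Real.pi) Real.pi).sub (intervalIntegrable_logChord _ _))).mul_continuousOn (by fun_prop)
  have hsi : IntervalIntegrable (fun β => (((c - logChord β) * Real.sin β : ℝ) : ℂ)) volume
      (-Real.pi) Real.pi := intervalIntegrable_ofReal (((by simp : IntervalIntegrable (fun _ => c)
        volume (-Real.pi) Real.pi).sub (intervalIntegrable_logChord _ _)).mul_continuousOn
          (by fun_prop))
  have ek : ∀ β : ℝ, Complex.exp (-(Complex.I * ((m + 1 : ℕ) : ℤ) * β)) =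
      Complex.exp (-(Complex.I * ((m + 1 : ℕ) * β : ℝ))) := fun β => by
    congr 1
    push_cast
    ring
  have e : ∀ β : ℝ, ((c - logChord β : ℝ) : ℂ) *
        (Real.sin β * (Complex.exp (-(Complex.I * ((m + 1 : ℕ) : ℤ) * β)) - 1) +
          Real.cos β * (Complex.I * ((m + 1 : ℕ) : ℤ) *
            Complex.exp (-(Complex.I * ((m + 1 : ℕ) : ℤ) * β)))) =
      (Complex.I / 2 * (m + 2) * (((c - logChord β : ℝ) : ℂ) *
          Complex.exp (-(Complex.I * ((m + 2 : ℕ) * β : ℝ)))) +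
        Complex.I / 2 * m * (((c - logChord β : ℝ) : ℂ) *
          Complex.exp (-(Complex.I * (m * β : ℝ))))) -
        (((c - logChord β) * Real.sin β : ℝ) : ℂ) := fun β => by
    have h1 := sin_mul_exp_succ m β
    have h2 := cos_mul_exp_succ m β
    rw [Complex.ofReal_mul]
    simp only [ek]
    push_cast at h1 h2 ⊢
    linear_combination ((c : ℂ) - logChord β) * (h1 + Complex.I * (m + 1) * h2)
  have hodd : ∫ β in (-Real.pi)..Real.pi, (c - logChord β) * Real.sin β = 0 :=
    integral_neg_pi_pi_eq_zero fun β => by rw [logChord_neg, Real.sin_neg, mul_neg]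
  rw [fourierMode_linearSpeed R hφ hper, integral_cos_mul_chordMultiplier hm]
  simp only [← hc, e]
  rw [intervalIntegral.integral_sub (((hwi _).const_mul _).add ((hwi _).const_mul _)) hsi,
    intervalIntegral.integral_add ((hwi _).const_mul _) ((hwi _).const_mul _),
    intervalIntegral.integral_const_mul, intervalIntegral.integral_const_mul,
    integral_sub_logChord_mul_exp c hm, integral_sub_logChord_mul_exp c (by omega),
    intervalIntegral.integral_ofReal, hodd]
  simp only [ek, intervalIntegral.integral_const_mul]
  rw [integral_exp_neg_I_mul (by omega)]
  congr 1
  push_cast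
  have hI := Complex.I_sq
  field_simp
  linear_combination (-2 * Real.pi : ℂ) * hI

/-! ### The multiplier of the Hilbert transform -/

/-- For Fubini the pole of cot(β/2) is moved: f(α-β) - f(α+β) is β times the continuous `g`, and β
cot(β/2) is the continuous weight `w`. The constant comes from the integral of sin(nβ) cot(β/2),
which is π. -/
theorem fourierMode_hilbertTransform {f : ℝ → ℝ} (hf : ContDiff ℝ 1 f)
    (hper : Function.Periodic f (2 * Real.pi)) {n : ℕ} (hn : n ≠ 0) :
    fourierMode (hilbertTransform f) n = -Complex.I * fourierMode f n := by
  have hd : Continuous (deriv f) := hf.continuous_deriv le_rfl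
  have hc := hf.continuous
  set g : ℝ → ℝ → ℝ := fun α β => ∫ t in (-1 : ℝ)..1, -deriv f (α + β * t) with hg
  set w : ℝ → ℝ := fun β => 2 * Real.cos (β / 2) / Real.sinc (β / 2) with hw
  have hgc : Continuous (Function.uncurry g) := by
    simp only [hg, Function.uncurry_def]
    exact intervalIntegral.continuous_parametric_intervalIntegral_of_continuous' (by
      simp only [Function.uncurry_def]
      fun_prop) _ _
  have hwi : IntervalIntegrable w volume 0 Real.pi :=
    ContinuousOn.intervalIntegrable (ContinuousOn.div (by fun_prop)
      (Real.continuous_sinc.comp (by fun_prop)).continuousOn fun β hβ => by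
        rw [Set.uIcc_of_le Real.pi_pos.le] at hβ
        exact (sinc_half_pos ⟨by linarith [hβ.1, Real.pi_pos], hβ.2⟩).ne')
  have hgβ : ∀ α β, β * g α β = f (α - β) - f (α + β) := fun α β => by
    have h := smul_integral_comp_add_mul (a := -1) (b := 1) (deriv f) β α
    rw [integral_deriv_eq_sub (fun x _ => hf.differentiable one_ne_zero x)
      (hd.intervalIntegrable _ _), smul_eq_mul] at h
    simp only [hg, intervalIntegral.integral_neg]
    rw [mul_neg, h]
    ring_nf
  have hwβ : ∀ β ∈ Set.uIoc 0 Real.pi, w β = β * Real.cot (β / 2) := fun β hβ => by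
    rw [Set.uIoc_of_le Real.pi_pos.le] at hβ
    have hs : Real.sin (β / 2) ≠ 0 :=
      (Real.sin_pos_of_pos_of_lt_pi (by linarith [hβ.1]) (by linarith [hβ.2, hβ.1])).ne'
    have h0 : β ≠ 0 := hβ.1.ne'
    rw [hw, Real.cot_eq_cos_div_sin]
    simp only
    rw [Real.sinc_of_ne_zero (div_ne_zero h0 two_ne_zero)]
    field_simp
  have e : hilbertTransform f = fun α => 1 / (2 * Real.pi) *
      ∫ β in (0 : ℝ)..Real.pi, w β * g α β := by
    funext α
    refine congrArg _ (intervalIntegral.integral_congr_ae (Eventually.of_forall fun β hβ => ?_))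
    rw [hwβ β hβ, mul_right_comm, hgβ]
  have hmode : ∀ β : ℝ, (β : ℂ) * fourierMode (fun α => g α β) n =
      -2 * Complex.I * (Real.sin (n * β) : ℂ) * fourierMode f n := fun β => by
    have hplus := fourierMode_comp_sub hper (-β) n
    simp only [sub_neg_eq_add] at hplus
    rw [← fourierMode_const_mul]
    simp only [hgβ]
    rw [fourierMode_sub (by fun_prop) (by fun_prop), fourierMode_comp_sub hper, hplus, ← sub_mul]
    congr 1
    have e1 : -(Complex.I * ((n : ℤ) : ℂ) * (β : ℂ)) = -(Complex.I * (n * β : ℝ)) := by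
      push_cast
      ring
    have e2 : -(Complex.I * ((n : ℤ) : ℂ) * ((-β : ℝ) : ℂ)) = -(Complex.I * (-(n * β) : ℝ)) := by
      push_cast
      ring
    rw [e1, e2, exp_neg_I_mul_eq, exp_neg_I_mul_eq, Real.cos_neg, Real.sin_neg]
    push_cast
    ring
  rw [e, fourierMode_const_mul, fourierMode_integral hwi hgc]
  have h1 : ∫ β in (0 : ℝ)..Real.pi, (w β : ℂ) * fourierMode (fun α => g α β) n =
      ∫ β in (0 : ℝ)..Real.pi, (-2 * Complex.I * fourierMode f n) *
        ((Real.sin (n * β) * Real.cot (β / 2) : ℝ) : ℂ) := by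
    refine intervalIntegral.integral_congr_ae (Eventually.of_forall fun β hβ => ?_)
    rw [hwβ β hβ, Complex.ofReal_mul, mul_right_comm, hmode]
    push_cast
    ring
  rw [h1, intervalIntegral.integral_const_mul, intervalIntegral.integral_ofReal,
    integral_sin_mul_cot hn]
  have hπ : (Real.pi : ℂ) ≠ 0 := by exact_mod_cast Real.pi_ne_zero
  push_cast
  field_simp

/-! ### From the normal speed to the tangent angle -/

section circleVariation

variable {V : ℝ → ℝ}

/-- The part of `circleVariation` that comes from the tangential speed. -/
theorem hasDerivAt_tangentialVariation (hV : Continuous V) (α : ℝ) :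
    HasDerivAt (fun α => (∫ η in (0 : ℝ)..α, V η) -
      (α / (2 * Real.pi)) * ∫ η in (-Real.pi)..Real.pi, V η)
      (V α - 1 / (2 * Real.pi) * ∫ η in (-Real.pi)..Real.pi, V η) α :=
  (integral_hasDerivAt_right (hV.intervalIntegrable _ _)
    (hV.stronglyMeasurableAtFilter _ _) hV.continuousAt).sub
      (((hasDerivAt_id' α).div_const _).mul_const _)

theorem periodic_tangentialVariation (hV : Continuous V)
    (hper : Function.Periodic V (2 * Real.pi)) :
    Function.Periodic (fun α => (∫ η in (0 : ℝ)..α, V η) -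
      (α / (2 * Real.pi)) * ∫ η in (-Real.pi)..Real.pi, V η) (2 * Real.pi) := fun α => by
  have h1 := hper.intervalIntegral_add_eq α (-Real.pi)
  rw [show -Real.pi + 2 * Real.pi = Real.pi by ring] at h1
  have h2 := integral_add_adjacent_intervals (hV.intervalIntegrable 0 α)
    (hV.intervalIntegrable (μ := volume) α (α + 2 * Real.pi))
  have hπ := Real.pi_ne_zero
  simp only
  rw [← h2, h1]
  field_simp
  ring

theorem periodic_deriv {f : ℝ → ℝ} {c : ℝ} (hf : Function.Periodic f c) :
    Function.Periodic (deriv f) c := fun α => by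
  rw [← deriv_comp_add_const, funext hf]

theorem continuous_tangentialVariation (hV : Continuous V) :
    Continuous (fun α => (∫ η in (0 : ℝ)..α, V η) -
      (α / (2 * Real.pi)) * ∫ η in (-Real.pi)..Real.pi, V η) :=
  continuous_iff_continuousAt.2 fun α => (hasDerivAt_tangentialVariation hV α).continuousAt

theorem continuous_circleVariation (hV : ContDiff ℝ 1 V) : Continuous (circleVariation V) :=
  (hV.continuous_deriv le_rfl).add (continuous_tangentialVariation hV.continuous)

theorem periodic_circleVariation (hV : ContDiff ℝ 1 V)
    (hper : Function.Periodic V (2 * Real.pi)) :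
    Function.Periodic (circleVariation V) (2 * Real.pi) :=
  (periodic_deriv hper).add (periodic_tangentialVariation hV.continuous hper)

/-- The tangential part is periodic with derivative V minus its mean, so on mode k ≠ 0 it divides by
ik; the total is ik + 1/(ik). -/
theorem fourierMode_circleVariation (hV : ContDiff ℝ 1 V)
    (hper : Function.Periodic V (2 * Real.pi)) {k : ℤ} (hk : k ≠ 0) :
    fourierMode (circleVariation V) k = Complex.I * (k - 1 / k) * fourierMode V k := by
  have hk' : (k : ℂ) ≠ 0 := by exact_mod_cast hk
  have hd := hV.continuous_deriv le_rfl
  have h1 := fourierMode_deriv (fun α => (hV.differentiable one_ne_zero α).hasDerivAt) hd hper k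
  have h2 := fourierMode_deriv (fun α => hasDerivAt_tangentialVariation hV.continuous α)
    (hV.continuous.sub continuous_const) (periodic_tangentialVariation hV.continuous hper) k
  rw [fourierMode_sub hV.continuous continuous_const, fourierMode_const _ hk, sub_zero] at h2
  have h3 := fourierMode_add hd (continuous_tangentialVariation hV.continuous) k
  refine h3.trans ?_
  rw [h1, h2]
  generalize fourierMode (fun α => (∫ η in (0 : ℝ)..α, V η) -
      (α / (2 * Real.pi)) * ∫ η in (-Real.pi)..Real.pi, V η) k = T
  have hI := Complex.I_sq
  field_simp
  linear_combination T * hI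

end circleVariation

/-! ### The linearization and its Fourier modes -/

theorem periodic_linearSpeed (R : ℝ) {φ : ℝ → ℝ} (hper : Function.Periodic φ (2 * Real.pi)) :
    Function.Periodic (linearSpeed R φ) (2 * Real.pi) := fun α => by
  simp only [linearSpeed, chordVariation, add_sub_right_comm α, hper _,
    periodic_deriv hper _]

theorem contDiff_of_forall_eq {n : ℕ} {V : ℝ → ℝ} {N : ℝ × ℝ → ℝ} {ε : ℝ}
    (hN : ∀ α, ContDiffAt ℝ n N (ε, α)) (h : ∀ α, N (ε, α) = V α) : ContDiff ℝ n V := by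
  rw [← funext h]
  exact contDiff_iff_contDiffAt.2 fun α =>
    ContDiffAt.comp (f := fun α : ℝ => (ε, α)) α (hN α) (by fun_prop)

theorem thetaRHS_linearization {θ : ℝ → ℝ} (hθ : ContDiff ℝ 2 θ)
    (hper : Function.Periodic θ (2 * Real.pi)) (γ : ℝ) {L : ℝ} (hL : 0 < L) :
    (∀ᶠ ε in 𝓝 (0 : ℝ),
      (∀ (j : Fin 2) (α : ℝ), IntervalIntegrable (layerIntegrand γ L (perturbed θ ε) j α)
        volume (-Real.pi) Real.pi) ∧
      ContDiff ℝ 1 (normalSpeed γ L (perturbed θ ε))) ∧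
    ContDiff ℝ 1 (fun α =>
      γ / (4 * Real.pi) * linearSpeed (L / (2 * Real.pi)) (fluctuation θ) α) ∧
    ∀ α : ℝ, HasDerivAt (fun ε : ℝ => thetaRHS γ L (perturbed θ ε) α)
      (2 * Real.pi / L * circleVariation (fun η =>
        γ / (4 * Real.pi) * linearSpeed (L / (2 * Real.pi)) (fluctuation θ) η) α) 0 := by
  have hθ1 : ContDiff ℝ 1 θ := hθ.of_le (by norm_num)
  obtain ⟨r, hr, hq, N, hN, hU, hN0⟩ := exists_normalSpeed_eq hθ hper γ hL
  have h0 : |(0 : ℝ)| < r := by simpa using hr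
  refine ⟨?_, contDiff_of_forall_eq (n := 1) (fun α => hN (0, α) h0) hN0, fun α => ?_⟩
  · have hIoo : ∀ᶠ ε in 𝓝 (0 : ℝ), |ε| < r :=
      (continuous_abs.tendsto (0 : ℝ)).eventually (gt_mem_nhds h0)
    filter_upwards [hIoo] with ε hε
    refine ⟨fun j α => intervalIntegrable_layerIntegrand hθ1 γ hL (hq ε hε α) j, ?_⟩
    exact contDiff_of_forall_eq (n := 1) (N := fun p => p.1 * N p) (ε := ε)
      (fun α => contDiff_fst.contDiffAt.mul (hN (ε, α) hε)) fun α => (hU (ε, α) hε).symm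
  · have h := hasDerivAt_thetaRHS hθ1 γ L hr hN hU α
    simpa only [hN0] using h

theorem fourierMode_linearPart_nat {θ : ℝ → ℝ} (hθ : ContDiff ℝ 2 θ)
    (hper : Function.Periodic θ (2 * Real.pi)) (γ : ℝ) {L : ℝ} (hL : 0 < L) {m : ℕ} (hm : m ≠ 0) :
    fourierMode (linearPart γ L θ) (m + 1 : ℕ) =
      ((-(2 * Real.pi / L) * (γ / (4 * Real.pi)) * (Real.pi * (m + 1 : ℕ)) : ℝ) : ℂ) *
        fourierMode (fluctuation θ) (m + 1 : ℕ) := by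
  obtain ⟨-, hV, hder⟩ := thetaRHS_linearization hθ hper γ hL
  have hφ1 : ContDiff ℝ 1 (fluctuation θ) := contDiff_fluctuation (n := 1) (hθ.of_le (by norm_num))
  have hVper : Function.Periodic (fun α =>
      γ / (4 * Real.pi) * linearSpeed (L / (2 * Real.pi)) (fluctuation θ) α) (2 * Real.pi) :=
    fun α => by simp only [periodic_linearSpeed _ (periodic_fluctuation hper) α]
  have e : linearPart γ L θ = _ := funext fun α => (hder α).deriv
  rw [e, fourierMode_const_mul, fourierMode_circleVariation hV hVper (by positivity),
    fourierMode_const_mul, fourierMode_linearSpeed_nat _ hφ1 (periodic_fluctuation hper) hm]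
  have hm' : (m : ℂ) ≠ 0 := by exact_mod_cast hm
  have hm1 : (m : ℂ) + 1 ≠ 0 := by exact_mod_cast m.succ_ne_zero
  have hm2 : (m : ℂ) + 2 ≠ 0 := by exact_mod_cast (by omega : m + 2 ≠ 0)
  have hI := Complex.I_sq
  have hk : (((m + 1 : ℕ) : ℤ) : ℂ) - 1 / (((m + 1 : ℕ) : ℤ) : ℂ) = m * (m + 2) / (m + 1) := by
    push_cast
    field_simp
    ring
  -- With k = m + 1 this is (k - 1/k) · k²/(k²-1) = k; the two factors i supply the minus sign.
  have hmul : (m : ℂ) * (m + 2) / (m + 1) * ((m + 1) ^ 2 / (m * (m + 2))) = m + 1 := by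
    field_simp
  rw [hk]
  push_cast
  linear_combination (2 * Real.pi / L * (γ / (4 * Real.pi)) * Real.pi *
    fourierMode (fluctuation θ) (m + 1)) * (Complex.I ^ 2 * hmul + (m + 1 : ℂ) * hI)

end StokesInterface

theorem mainTheorem2 (γ L : ℝ) (hL : 0 < L) (θ : ℝ → ℝ)
    (hθ : ContDiff ℝ 2 θ) (hper : Function.Periodic θ (2 * Real.pi)) :
    -- the nonlinear equation makes classical sense near the circle
    (∀ᶠ ε in 𝓝 (0 : ℝ),
      (∀ (j : Fin 2) (α : ℝ), IntervalIntegrable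
        (StokesInterface.layerIntegrand γ L (StokesInterface.perturbed θ ε) j α)
        MeasureTheory.volume (-Real.pi) Real.pi) ∧
      ContDiff ℝ 1 (StokesInterface.normalSpeed γ L (StokesInterface.perturbed θ ε))) ∧
    -- the linear part exists and is a continuous periodic function
    (∀ α : ℝ, DifferentiableAt ℝ
      (fun ε : ℝ => StokesInterface.thetaRHS γ L (StokesInterface.perturbed θ ε) α) 0) ∧
    Continuous (StokesInterface.linearPart γ L θ) ∧
    Function.Periodic (StokesInterface.linearPart γ L θ) (2 * Real.pi) ∧
    -- its Fourier multiplier for `|k| > 1`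
    (∀ k : ℤ, 1 < |k| →
      StokesInterface.fourierMode (StokesInterface.linearPart γ L θ) k =
        ((-(2 * Real.pi / L) * (γ / (4 * Real.pi)) * (Real.pi * |(k : ℝ)|) : ℝ) : ℂ) *
          StokesInterface.fourierMode (StokesInterface.fluctuation θ) k) ∧
    -- on these modes it is a multiple of the Hilbert transform of the derivative
    (∀ k : ℤ, 1 < |k| →
      StokesInterface.fourierMode (StokesInterface.linearPart γ L θ) k =
        ((-(2 * Real.pi / L) * (γ / (4 * Real.pi)) * Real.pi : ℝ) : ℂ) *
          StokesInterface.fourierMode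
            (StokesInterface.hilbertTransform (deriv (StokesInterface.fluctuation θ))) k) ∧
    -- the multiplier vanishes at `k = ±1`
    (∀ k : ℤ, |k| = 1 →
      StokesInterface.fourierMode (StokesInterface.linearPart γ L θ) k = 0) := by
  obtain ⟨hev, hV, hder⟩ := StokesInterface.thetaRHS_linearization hθ hper γ hL
  have hφp := StokesInterface.periodic_fluctuation hper
  have hφ := StokesInterface.contDiff_fluctuation (n := 2) hθ
  have hφ' : ContDiff ℝ 1 (deriv (StokesInterface.fluctuation θ)) := hφ.deriv' (n := 1)
  have hVper : Function.Periodic (fun α => γ / (4 * Real.pi) * StokesInterface.linearSpeed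
      (L / (2 * Real.pi)) (StokesInterface.fluctuation θ) α) (2 * Real.pi) :=
    fun α => by simp only [StokesInterface.periodic_linearSpeed _ hφp α]
  have e : StokesInterface.linearPart γ L θ = _ := funext fun α => (hder α).deriv
  -- a relation between Fourier modes with a real coefficient passes from `k` to `-k`
  have hsymm : ∀ {f g : ℝ → ℝ} {c : ℝ} {k : ℤ},
      StokesInterface.fourierMode f k = (c : ℂ) * StokesInterface.fourierMode g k →
      StokesInterface.fourierMode f (-k) = (c : ℂ) * StokesInterface.fourierMode g (-k) := by
    intro f g c k h
    rw [StokesInterface.fourierMode_neg, StokesInterface.fourierMode_neg, h, map_mul,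
      Complex.conj_ofReal]
  -- The modes k ≥ 2 are written k = m + 1 with m ≥ 1, and the negative ones are obtained by
  -- reflection.
  have hcase : ∀ {P : ℤ → Prop}, (∀ m : ℕ, m ≠ 0 → P ((m + 1 : ℕ) : ℤ)) → (∀ k, P k → P (-k)) →
      ∀ k : ℤ, 1 < |k| → P k := by
    intro P h1 h2 k hk
    have hpos : ∀ k : ℤ, 1 < k → P k := fun k hk => by
      obtain ⟨m, rfl⟩ := Int.eq_ofNat_of_zero_le (by omega : 0 ≤ k - 1) |>.imp
        fun m hm => (by omega : k = ((m + 1 : ℕ) : ℤ))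
      exact h1 m (by omega)
    rcases lt_abs.1 hk with h | h
    · exact hpos k h
    · simpa using h2 (-k) (hpos (-k) h)
  refine ⟨hev, fun α => (hder α).differentiableAt, ?_, ?_, ?_, ?_, ?_⟩
  · rw [e]
    exact (StokesInterface.continuous_circleVariation hV).const_mul _
  · rw [e]
    intro α
    simp only [StokesInterface.periodic_circleVariation hV hVper α]
  · refine hcase (fun m hm => ?_) fun k hk => ?_
    · rw [StokesInterface.fourierMode_linearPart_nat hθ hper γ hL hm, Int.cast_natCast,
        Nat.abs_cast]
    · rw [Int.cast_neg, abs_neg]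
      exact hsymm hk
  · refine hcase (fun m hm => ?_) fun k hk => hsymm hk
    rw [StokesInterface.fourierMode_linearPart_nat hθ hper γ hL hm,
      StokesInterface.fourierMode_hilbertTransform hφ' (StokesInterface.periodic_deriv hφp)
        m.succ_ne_zero,
      StokesInterface.fourierMode_deriv (fun α => (hφ.differentiable two_ne_zero α).hasDerivAt)
        hφ'.continuous hφp]
    push_cast
    linear_combination (2 * Real.pi / L * (γ / (4 * Real.pi)) * Real.pi * (m + 1 : ℂ) *
      StokesInterface.fourierMode (StokesInterface.fluctuation θ) (m + 1)) * -Complex.I_sq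
  · intro k hk
    have hk0 : k ≠ 0 := by
      rintro rfl
      simp at hk
    rw [e, StokesInterface.fourierMode_const_mul,
      StokesInterface.fourierMode_circleVariation hV hVper hk0]
    -- The factor k - 1/k vanishes at k = ±1, whatever the corresponding mode of the normal speed.
    rcases (abs_eq zero_le_one).1 hk with rfl | rfl <;> simp
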